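/- **Theorem (matricvariate $T$ distribution).** Let $\mathfrak F$ be one of the real normed division algebras $\mathbb R$, $\mathbb C$, $\mathbb H$ (real numbers, complex numbers, quaternions), of real dimension $\beta=1,2,4$ respectively, with conjugation $x\mapsto\bar x$, and write $A^*=\bar A^{T}$. For a Hermitian positive definite matrix $A$ over $\mathfrak F$ let $|A|$ be its determinant (the product of its eigenvalues; equivalently, the $\beta$-th root of the determinant of the real-linear map $x\mapsto Ax$ on $\mathfrak F^m$), and let $\mathfrak P_m^\beta$ be the cone of Hermitian positive definite $m\times m$ matrices over $\mathfrak F$. Let $(dX)=\prod_{i,j,k}dx_{ij}^{(k)}$ be Lebesgue measure on $\mathfrak F^{m\times n}$ in the $\beta mn$ real coordinates, let $(dA)=\prod_i da_{ii}\prod_{i<j}\prod_{k=1}^{\beta}da_{ij}^{(k)}$ be Lebesgue measure on the Hermitian $m\times m$ matrices, and put $$\Gamma_m^\beta[a]=\int_{\mathfrak P_m^\beta}e^{-\operatorname{tr}A}\,|A|^{a-(m-1)\beta/2-1}\,(dA),\qquad a>(m-1)\beta/2 .$$ Let $\Xi\in\mathfrak P_m^\beta$, $\Sigma\in\mathfrak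 P_n^\beta$, $\mu\in\mathfrak F^{m\times n}$, and let $\nu\in\mathbb R$ satisfy $\nu>\beta(m-1)$. Let $V\sim\mathcal W_m^\beta(\nu,\Xi)$, i.e. $V$ has on $\mathfrak P_m^\beta$ the density $$\frac{1}{(2\beta^{-1})^{\beta m\nu/2}\,\Gamma_m^\beta[\beta\nu/2]\,|\Xi|^{\beta\nu/2}}\;|V|^{\beta(\nu-m+1)/2-1}\exp\{-\tfrac{\beta}{2}\operatorname{Re}\operatorname{tr}\,\Xi^{-1}V\}$$ with respect to $(dV)$, and let $Y\sim\mathcal N_{m\times n}^\beta(0,I_m\otimes\Sigma)$, i.e. $Y$ has on $\mathfrak F^{m\times n}$ the density $$\frac{1}{(2\pi\beta^{-1})^{\beta mn/2}\,|\Sigma|^{\beta m/2}}\exp\{-\tfrac{\beta}{2}\operatorname{Re}\operatorname{tr}\,Y\Sigma^{-1}Y^*\}$$ with respect to $(dY)$. Let $L$ be any random $m\times m$ matrix over $\mathfrak F$ that is a square root of $V$ in the sense that $L^*L=V$ almost surely (for instance, any Hermitian square root, for which $L=L^*$ and $LL^*=L^2=V$), and assume that $L$ is independent of $Y$ (which is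 the case when $V$ is independent of $Y$ and $L$ is a measurable function of $V$). Then $$T=L^{-1}Y+\mu$$ has, with respect to Lebesgue measure $(dT)$ on $\mathfrak F^{m\times n}$, the density $$\frac{\Gamma_m^\beta[\beta(n+\nu)/2]}{\pi^{mn\beta/2}\,\Gamma_m^\beta[\beta\nu/2]\,|\Xi|^{\beta\nu/2}\,|\Sigma|^{\beta m/2}}\;\bigl|\Xi^{-1}+(T-\mu)\Sigma^{-1}(T-\mu)^*\bigr|^{-\beta(n+\nu)/2}.$$ -/

import Mathlib

open MeasureTheory ProbabilityTheory
open scoped Matrix Quaternion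

noncomputable section

namespace MatricT

/-- A (necessarily finite-dimensional, associative) real normed division algebra `F`:
`NormedDivisionRing` supplies `‖a * b‖ = ‖a‖ * ‖b‖`, `star` is the conjugation, and
`basis` is an orthonormal real basis, so that `basis.repr x k` is the `k`-th real
coordinate `x⁽ᵏ⁾` of `x`. The number `β` is the real dimension of `F`.
The instances below are `ℝ`, `ℂ` and `ℍ`, with `β = 1, 2, 4` and their standard bases. -/
class RealNormedDivisionAlgebra (F : Type*) [NormedDivisionRing F] [NormedAlgebra ℝ F]
    [StarRing F] where
  β : ℕ
  basis : Module.Basis (Fin β) ℝ F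
  norm_sq_eq : ∀ x : F, ‖x‖ ^ 2 = ∑ k, (basis.repr x k) ^ 2
  star_mul_self_eq : ∀ x : F, star x * x = algebraMap ℝ F (‖x‖ ^ 2)

instance instReal : RealNormedDivisionAlgebra ℝ where
  β := 1
  basis := Module.Basis.singleton (Fin 1) ℝ
  norm_sq_eq x := by simp
  star_mul_self_eq x := by simp [sq]

instance instComplex : RealNormedDivisionAlgebra ℂ where
  β := 2
  basis := Complex.basisOneI
  norm_sq_eq x := by
    rw [Complex.sq_norm, Complex.normSq_apply]
    simp [Complex.coe_basisOneI_repr, sq]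
  star_mul_self_eq x := by
    have := Complex.normSq_eq_conj_mul_self (z := x)
    simp only [Complex.sq_norm, Complex.coe_algebraMap, this]
    rfl

instance instQuaternion : RealNormedDivisionAlgebra ℍ where
  β := 4
  basis := QuaternionAlgebra.basisOneIJK (-1 : ℝ) 0 (-1)
  norm_sq_eq x := by
    rw [sq, ← Quaternion.normSq_eq_norm_mul_self, Quaternion.normSq_def']
    simp [Fin.sum_univ_four]
    rfl
  star_mul_self_eq x := by
    rw [Quaternion.star_mul_self, sq, ← Quaternion.normSq_eq_norm_mul_self]
    rfl

/-- Matrices over a measurable space carry the product `σ`-algebra of their entries. -/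
instance instMeasurableSpaceMatrix {ι κ F : Type*} [MeasurableSpace F] :
    MeasurableSpace (Matrix ι κ F) :=
  inferInstanceAs (MeasurableSpace (ι → κ → F))

section

variable (F : Type*) [NormedDivisionRing F] [NormedAlgebra ℝ F] [StarRing F]
  [RealNormedDivisionAlgebra F]

/-- The real dimension of the algebra, as a natural number. -/
abbrev dim : ℕ := RealNormedDivisionAlgebra.β F

/-- The real dimension `β` of the algebra, as a real number. -/
abbrev beta : ℝ := (RealNormedDivisionAlgebra.β F : ℝ)

variable {F}

/-- The element of `F` with given real coordinates. -/
def ofCoord (c : Fin (dim F) → ℝ) : F :=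
  ∑ k, c k • (RealNormedDivisionAlgebra.basis (F := F) k)

/-- The real part of `x`, i.e. the Euclidean inner product of `1` and `x`. -/
def re (x : F) : ℝ :=
  ∑ k, (RealNormedDivisionAlgebra.basis (F := F)).repr 1 k *
    (RealNormedDivisionAlgebra.basis (F := F)).repr x k

/-- `x + x̄ = 2 Re x`, so that `re` is the usual real part. -/
theorem add_star_eq (x : F) : x + star x = algebraMap ℝ F (2 * re x) := by
  have h1 := RealNormedDivisionAlgebra.star_mul_self_eq (1 + x)
  have h2 : ‖1 + x‖ ^ 2 = ‖(1 : F)‖ ^ 2 + 2 * re x + ‖x‖ ^ 2 := by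
    simp only [RealNormedDivisionAlgebra.norm_sq_eq, re, map_add, Finsupp.add_apply,
      Finset.mul_sum, ← Finset.sum_add_distrib]
    exact Finset.sum_congr rfl fun k _ => by ring
  rw [h2, map_add, map_add, ← RealNormedDivisionAlgebra.star_mul_self_eq x] at h1
  simp only [star_add, star_one, add_mul, mul_add, one_mul, mul_one, norm_one, one_pow,
    map_one] at h1
  have h3 : (1 + star x + (x + star x * x)) = 1 + (x + star x) + star x * x := by abel
  rw [h3] at h1
  exact add_left_cancel (add_right_cancel h1)

/-- `A` is a Hermitian positive definite matrix over `F` (for Hermitian `A` the scalar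
`x* A x` is real, so it equals its real part). -/
def PosDef {m : ℕ} (A : Matrix (Fin m) (Fin m) F) : Prop :=
  Aᴴ = A ∧ ∀ x : Fin m → F, x ≠ 0 → 0 < re (star x ⬝ᵥ (A *ᵥ x))

/-- The real-linear endomorphism `x ↦ A x` of `F ^ m`. -/
def mulVecReal {m : ℕ} (A : Matrix (Fin m) (Fin m) F) : (Fin m → F) →ₗ[ℝ] (Fin m → F) where
  toFun x := A *ᵥ x
  map_add' x y := Matrix.mulVec_add A x y
  map_smul' r x := Matrix.mulVec_smul A r x

/-- The (normalised, non-negative) determinant `|A|` of a square matrix over `F`: the `β`-th root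
of the absolute value of the determinant of the real-linear map `x ↦ A x` of `F ^ m`.
It is the absolute value of the usual determinant over `ℝ` and `ℂ` and the Dieudonné determinant
(with values in the non-negative reals) over `ℍ`; it is multiplicative, and on a Hermitian positive
definite matrix it is the determinant, that is, the product of the eigenvalues. -/
def det {m : ℕ} (A : Matrix (Fin m) (Fin m) F) : ℝ :=
  |LinearMap.det (mulVecReal A)| ^ (1 / beta F)

theorem det_mul {m : ℕ} (A B : Matrix (Fin m) (Fin m) F) : det (A * B) = det A * det B := by
  have : mulVecReal (A * B) = mulVecReal A ∘ₗ mulVecReal B := by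
    refine LinearMap.ext fun x => ?_
    simp [mulVecReal]
  rw [det, this, LinearMap.det_comp, abs_mul, Real.mul_rpow (abs_nonneg _) (abs_nonneg _)]
  rfl

theorem det_real {m : ℕ} (A : Matrix (Fin m) (Fin m) ℝ) : det A = |A.det| := by
  have h : mulVecReal A = Matrix.toLin' A := rfl
  have hb : beta ℝ = 1 := Nat.cast_one
  rw [det, h, LinearMap.det_toLin', hb]
  simp

theorem det_complex {m : ℕ} (A : Matrix (Fin m) (Fin m) ℂ) : det A = ‖A.det‖ := by
  have h : mulVecReal A = (Matrix.toLin' A).restrictScalars ℝ := rfl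
  have hb : beta ℂ = 2 := Nat.cast_two
  rw [det, h, LinearMap.det_restrictScalars, LinearMap.det_toLin', hb, Algebra.norm_complex_apply,
    Complex.normSq_eq_norm_sq, abs_of_nonneg (sq_nonneg _), ← Real.sqrt_eq_rpow,
    Real.sqrt_sq (norm_nonneg _)]

/-- On a real diagonal matrix with non-negative entries, `|A|` is the product of the entries. -/
theorem det_diagonal {m : ℕ} (d : Fin m → ℝ) (hd : ∀ i, 0 ≤ d i) :
    det (Matrix.diagonal fun i => algebraMap ℝ F (d i)) = ∏ i, d i := by
  have h : mulVecReal (Matrix.diagonal fun i => algebraMap ℝ F (d i)) =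
      LinearMap.pi fun i => (d i • (LinearMap.id : F →ₗ[ℝ] F)) ∘ₗ LinearMap.proj i := by
    refine LinearMap.ext fun x => funext fun i => ?_
    simp [mulVecReal, Matrix.mulVec_diagonal, Algebra.smul_def]
  have hfin : Module.finrank ℝ F = dim F := by
    simp [Module.finrank_eq_card_basis (RealNormedDivisionAlgebra.basis (F := F))]
  have : Module.Finite ℝ F := .of_basis (RealNormedDivisionAlgebra.basis (F := F))
  have hpos : 0 < dim F := hfin ▸ Module.finrank_pos
  have hdet : LinearMap.det (mulVecReal (Matrix.diagonal fun i => algebraMap ℝ F (d i))) =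
      (∏ i, d i) ^ dim F := by
    rw [h, LinearMap.det_pi]
    simp [LinearMap.det_smul, hfin, Finset.prod_pow]
  have hprod : 0 ≤ ∏ i, d i := Finset.prod_nonneg fun i _ => hd i
  rw [det, hdet, abs_of_nonneg (pow_nonneg hprod _), one_div,
    Real.pow_rpow_inv_natCast hprod hpos.ne']

/-- The Lebesgue measure `(dX)` on `F ^ (m × n)`, in the `β m n` real coordinates of `X`. -/
def lebesgue (F : Type*) [NormedDivisionRing F] [NormedAlgebra ℝ F] [StarRing F]
    [RealNormedDivisionAlgebra F] [MeasurableSpace F] (m n : ℕ) :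
    Measure (Matrix (Fin m) (Fin n) F) :=
  (volume : Measure (Fin m → Fin n → Fin (dim F) → ℝ)).map
    fun c => Matrix.of fun i j => ofCoord (c i j)

/-- The Hermitian matrix with real diagonal entries `c.1 i` and with strictly upper triangular
entries `sᵢⱼ` having the real coordinates `c.2 (i, j)`. -/
def hermitianOfCoord {m : ℕ}
    (c : (Fin m → ℝ) × ({p : Fin m × Fin m // p.1 < p.2} → Fin (dim F) → ℝ)) :
    Matrix (Fin m) (Fin m) F :=
  Matrix.of fun i j =>
    if h : i < j then ofCoord (c.2 ⟨(i, j), h⟩)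
    else if h : j < i then star (ofCoord (c.2 ⟨(j, i), h⟩))
    else algebraMap ℝ F (c.1 i)

/-- The Lebesgue measure `(dS)` on the space of Hermitian `m × m` matrices over `F`, in the real
coordinates `sᵢᵢ` and `sᵢⱼ⁽ᵏ⁾`, `i < j` (as a measure on all `m × m` matrices, carried by the
Hermitian ones). -/
def lebesgueHermitian (F : Type*) [NormedDivisionRing F] [NormedAlgebra ℝ F] [StarRing F]
    [RealNormedDivisionAlgebra F] [MeasurableSpace F] (m : ℕ) :
    Measure (Matrix (Fin m) (Fin m) F) :=
  (volume : Measure ((Fin m → ℝ) ×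
    ({p : Fin m × Fin m // p.1 < p.2} → Fin (dim F) → ℝ))).map hermitianOfCoord

/-- The Lebesgue measure restricted to the cone of positive definite matrices. -/
def lebesgueCone (F : Type*) [NormedDivisionRing F] [NormedAlgebra ℝ F] [StarRing F]
    [RealNormedDivisionAlgebra F] [MeasurableSpace F] (m : ℕ) :
    Measure (Matrix (Fin m) (Fin m) F) :=
  (lebesgueHermitian F m).restrict {A | PosDef A}

/-- The multivariate Gamma function
`Γ_m^β[a] = ∫_{A > 0} etr(-A) |A| ^ (a - (m - 1) β / 2 - 1) (dA)`. -/
def multiGamma (F : Type*) [NormedDivisionRing F] [NormedAlgebra ℝ F] [StarRing F]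
    [RealNormedDivisionAlgebra F] [MeasurableSpace F] (m : ℕ) (a : ℝ) : ℝ :=
  ∫ A, Real.exp (-re (Matrix.trace A)) * det A ^ (a - ((m : ℝ) - 1) * beta F / 2 - 1)
    ∂(lebesgueCone F m)

/-- The random element `X` has the density `f` with respect to `μ`. -/
def HasDensity {Ω E : Type*} [MeasurableSpace Ω] [MeasurableSpace E] (X : Ω → E) (P : Measure Ω)
    (μ : Measure E) (f : E → ℝ) : Prop :=
  AEMeasurable X P ∧ P.map X = μ.withDensity fun x => ENNReal.ofReal (f x)

/-- The density of the Wishart distribution `W_m^β(ν, Ξ)` on the cone of positive definite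
matrices. -/
def wishartDensity [MeasurableSpace F] {m : ℕ} (ν : ℝ) (Ξ V : Matrix (Fin m) (Fin m) F) : ℝ :=
  1 / ((2 / beta F) ^ (beta F * m * ν / 2) * multiGamma F m (beta F * ν / 2) *
      det Ξ ^ (beta F * ν / 2)) *
    det V ^ (beta F * (ν - m + 1) / 2 - 1) *
    Real.exp (-(beta F / 2) * re (Matrix.trace (Ring.inverse Ξ * V)))

/-- `V ∼ W_m^β(ν, Ξ)`. -/
def IsWishart {Ω : Type*} [MeasurableSpace Ω] [MeasurableSpace F] {m : ℕ}
    (V : Ω → Matrix (Fin m) (Fin m) F) (P : Measure Ω) (ν : ℝ)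
    (Ξ : Matrix (Fin m) (Fin m) F) : Prop :=
  HasDensity V P (lebesgueCone F m) (wishartDensity ν Ξ)

/-- The density of the matrix normal distribution `N_{m×n}^β(M, Θ ⊗ S)`. -/
def normalDensity {m n : ℕ} (M : Matrix (Fin m) (Fin n) F) (Θ : Matrix (Fin m) (Fin m) F)
    (S : Matrix (Fin n) (Fin n) F) (Y : Matrix (Fin m) (Fin n) F) : ℝ :=
  1 / ((2 * Real.pi / beta F) ^ (beta F * m * n / 2) *
      det Θ ^ (beta F * n / 2) * det S ^ (beta F * m / 2)) *
    Real.exp (-(beta F / 2) *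
      re (Matrix.trace (Ring.inverse Θ * (Y - M) * Ring.inverse S * (Y - M)ᴴ)))

/-- `Y ∼ N_{m×n}^β(M, Θ ⊗ S)`. -/
def IsMatrixNormal {Ω : Type*} [MeasurableSpace Ω] [MeasurableSpace F] {m n : ℕ}
    (Y : Ω → Matrix (Fin m) (Fin n) F) (P : Measure Ω) (M : Matrix (Fin m) (Fin n) F)
    (Θ : Matrix (Fin m) (Fin m) F) (S : Matrix (Fin n) (Fin n) F) : Prop :=
  HasDensity Y P (lebesgue F m n) (normalDensity M Θ S)

end

end MatricT

end

/-! Fix `L` with `Lᴴ * L = V`. The substitution `Y = L (T - μ)` has Jacobian `|L| ^ (β n)`, so given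
`L` the density of `T` is `|L| ^ (β n)` times the normal density at `L (T - μ)`. As `|L|² = |V|` and
the real trace is cyclic, this depends on `L` only through `V`
(`conditionalDensity_conjTranspose_mul_self`): the choice of square root is irrelevant. Independence
and Tonelli then present the law of `T` as a Wishart mixture (`lintegral_inverse_mul_add`).

The product of the two densities is a constant times `|V| ^ p exp(-(β/2) Re tr (A V))` with `A = Ξ⁻¹
+ (T - μ) Σ⁻¹ (T - μ)*`. Writing `(β/2) A = Bᴴ * B` and substituting `B V Bᴴ` turns its integral
into a power of `|A|` times a Gamma integral (`lintegral_cone_det_rpow_mul_exp`). The Jacobian of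
this congruence is `|B| ^ (2 + (m - 1) β)`; it is needed only for `B` a positive diagonal matrix
times a unitary one, and the spectral theorem supplies such a `B` (`abs_det_congruence`).

To treat `ℝ`, `ℂ` and `ℍ` at once, all determinants are those of real-linear maps, and `Re tr`
replaces the trace. Integrals stay in `[0, ∞]`; that the Gamma factors are nonzero or finite is read
off from the total mass one of the laws involved. -/

namespace MatricT

/-! ### Adjoint and self-adjoint maps on real spaces. -/

section LinearAlgebra

variable {E : Type*} [AddCommGroup E] [Module ℝ E] [FiniteDimensional ℝ E]

/-- Adjoint endomorphisms with respect to a definite bilinear form have the same determinant. -/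
theorem det_eq_det_of_adjoint (B : E →ₗ[ℝ] E →ₗ[ℝ] ℝ) (hB : ∀ x, B x x = 0 → x = 0)
    (f g : E →ₗ[ℝ] E) (h : ∀ x y, B (f x) y = B x (g y)) :
    LinearMap.det f = LinearMap.det g := by
  have hinj : Function.Injective B := by
    rw [injective_iff_map_eq_zero]
    intro x hx
    exact hB x (by rw [hx]; rfl)
  let e : E ≃ₗ[ℝ] Module.Dual ℝ E :=
    LinearMap.linearEquivOfInjective B hinj Subspace.dual_finrank_eq.symm
  -- Through the identification of `E` with its dual given by `B`, adjointness says that `f` is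
  -- conjugate to the transpose of `g`.
  have hfg : (e : E →ₗ[ℝ] Module.Dual ℝ E) ∘ₗ f ∘ₗ (e.symm : Module.Dual ℝ E →ₗ[ℝ] E) =
      g.dualMap := by
    refine LinearMap.ext fun φ => LinearMap.ext fun y => ?_
    have := h (e.symm φ) y
    have h2 : B (e.symm φ) = φ := e.apply_symm_apply φ
    rw [h2] at this
    simpa [e] using this
  rw [← LinearMap.det_conj f e, hfg, LinearMap.det_dualMap]

/-- A self-adjoint endomorphism of a nontrivial space has a real eigenvector. -/
theorem exists_eigenvector_of_selfAdjoint [Nontrivial E] (B : E →ₗ[ℝ] E →ₗ[ℝ] ℝ)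
    (hsymm : ∀ x y, B x y = B y x) (hpos : ∀ x, x ≠ 0 → 0 < B x x)
    (f : E →ₗ[ℝ] E) (h : ∀ x y, B (f x) y = B x (f y)) :
    ∃ (l : ℝ) (x : E), x ≠ 0 ∧ f x = l • x := by
  let core : InnerProductSpace.Core ℝ E :=
    { inner := fun x y => B x y
      conj_inner_symm := fun x y => by simp [hsymm x y]
      re_inner_nonneg := fun x => by
        rcases eq_or_ne x 0 with rfl | hx
        · simp
        · exact (hpos x hx).le
      add_left := fun x y z => by simp
      smul_left := fun x y r => by simp
      definite := fun x hx => by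
        by_contra hne
        exact (hpos x hne).ne' hx }
  let _ : NormedAddCommGroup E := core.toNormedAddCommGroup
  let _ : InnerProductSpace ℝ E := InnerProductSpace.ofCore core.toCore
  have hf : f.IsSymmetric := h
  -- The supremum of the Rayleigh quotient is an eigenvalue.
  obtain ⟨x, hx⟩ := hf.hasEigenvalue_iSup_of_finiteDimensional.exists_hasEigenvector
  exact ⟨_, x, hx.2, hx.apply_eq_smul⟩

end LinearAlgebra

/-! ### Real part, normalised determinant and positive definiteness over `F`. -/

section Algebra

variable {F : Type*} [NormedDivisionRing F] [NormedAlgebra ℝ F] [StarRing F]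
  [RealNormedDivisionAlgebra F]

instance instFiniteDimensional : FiniteDimensional ℝ F :=
  .of_basis (RealNormedDivisionAlgebra.basis (F := F))

theorem finrank_eq_dim : Module.finrank ℝ F = dim F := by
  simp [Module.finrank_eq_card_basis (RealNormedDivisionAlgebra.basis (F := F))]

theorem beta_pos : 0 < beta F := by
  have : 0 < dim F := finrank_eq_dim (F := F) ▸ Module.finrank_pos
  exact_mod_cast this

theorem re_add (x y : F) : re (x + y) = re x + re y := by
  simp [re, mul_add, Finset.sum_add_distrib]

theorem re_smul (r : ℝ) (x : F) : re (r • x) = r * re x := by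
  simp only [re, map_smul, Finsupp.smul_apply, smul_eq_mul, Finset.mul_sum]
  exact Finset.sum_congr rfl fun k _ => by ring

variable (F) in
/-- The real part as a linear functional. -/
noncomputable def reLinear : F →ₗ[ℝ] ℝ where
  toFun := re
  map_add' := re_add
  map_smul' := re_smul

theorem re_zero : re (0 : F) = 0 := map_zero (reLinear F)

theorem re_sum {ι : Type*} (s : Finset ι) (f : ι → F) : re (∑ i ∈ s, f i) = ∑ i ∈ s, re (f i) :=
  map_sum (reLinear F) f s

theorem re_algebraMap (r : ℝ) : re (algebraMap ℝ F r) = r := by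
  have h1 : re (1 : F) = 1 := by
    have := RealNormedDivisionAlgebra.norm_sq_eq (1 : F)
    simp only [norm_one, one_pow] at this
    rw [this]
    exact Finset.sum_congr rfl fun k _ => by ring
  rw [Algebra.algebraMap_eq_smul_one, re_smul, h1, mul_one]

theorem star_algebraMap (r : ℝ) : star (algebraMap ℝ F r) = algebraMap ℝ F r := by
  have h := add_star_eq (algebraMap ℝ F r)
  rw [re_algebraMap, two_mul, map_add] at h
  exact add_left_cancel h

theorem star_smul_real (r : ℝ) (x : F) : star (r • x) = r • star x := by
  rw [Algebra.smul_def, star_mul, star_algebraMap, ← Algebra.commutes, Algebra.smul_def]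

theorem re_star (x : F) : re (star x) = re x := by
  have h1 := add_star_eq x
  have h2 := add_star_eq (star x)
  rw [star_star, add_comm, h1] at h2
  have := (algebraMap ℝ F).injective h2
  linarith

theorem norm_star_eq (x : F) : ‖star x‖ = ‖x‖ := by
  rcases eq_or_ne x 0 with rfl | hx
  · simp
  · have h := congrArg norm (RealNormedDivisionAlgebra.star_mul_self_eq x)
    rw [norm_mul, norm_algebraMap', norm_pow, norm_norm, sq] at h
    exact mul_right_cancel₀ (norm_ne_zero_iff.2 hx) h

theorem re_star_mul_self (x : F) : re (star x * x) = ‖x‖ ^ 2 := by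
  rw [RealNormedDivisionAlgebra.star_mul_self_eq, re_algebraMap]

theorem re_mul_star_self (x : F) : re (x * star x) = ‖x‖ ^ 2 := by
  have := re_star_mul_self (star x)
  rwa [star_star, norm_star_eq] at this

/-- Polarise the two expressions `star z * z` and `z * star z` of the squared norm at `z = x + y`.
This makes `Re tr` cyclic even when `F` is not commutative. -/
theorem re_mul_comm (x y : F) : re (x * y) = re (y * x) := by
  have key : ∀ x y : F, re (star x * y) = re (y * star x) := by
    intro x y
    have h1 := re_star_mul_self (x + y)
    have h2 := re_mul_star_self (x + y)
    have h3 : re (star y * x) = re (star x * y) := by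
      rw [← re_star (star y * x), star_mul, star_star]
    have h4 : re (x * star y) = re (y * star x) := by
      rw [← re_star (x * star y), star_mul, star_star]
    simp only [star_add, add_mul, mul_add, re_add, re_star_mul_self, re_mul_star_self] at h1 h2
    linarith
  have := key (star x) y
  rwa [star_star] at this

theorem re_trace_mul_comm {ι κ : Type*} [Fintype ι] [Fintype κ] (A : Matrix ι κ F)
    (B : Matrix κ ι F) : re (A * B).trace = re (B * A).trace := by
  simp only [Matrix.trace, Matrix.diag, Matrix.mul_apply, re_sum]
  rw [Finset.sum_comm]
  exact Finset.sum_congr rfl fun j _ => Finset.sum_congr rfl fun i _ => re_mul_comm _ _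

theorem conjTranspose_smul_real {ι κ : Type*} (r : ℝ) (A : Matrix ι κ F) :
    (r • A)ᴴ = r • Aᴴ := by
  ext i j
  simp [star_smul_real]

/-- The real inner product `Re (x* y)` of vectors. -/
noncomputable def vecForm (F : Type*) [NormedDivisionRing F] [NormedAlgebra ℝ F] [StarRing F]
    [RealNormedDivisionAlgebra F] (m : ℕ) : (Fin m → F) →ₗ[ℝ] (Fin m → F) →ₗ[ℝ] ℝ :=
  LinearMap.mk₂ ℝ (fun x y => re (star x ⬝ᵥ y))
    (fun x x' y => by simp [re_add])
    (fun r x y => by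
      have : star (r • x) = r • star x := funext fun i => star_smul_real r (x i)
      simp [this, re_smul])
    (fun x y y' => by simp [re_add])
    (fun r x y => by simp [re_smul])

variable {m : ℕ}

theorem vecForm_apply (x y : Fin m → F) : vecForm F m x y = re (star x ⬝ᵥ y) := rfl

theorem vecForm_symm (x y : Fin m → F) : vecForm F m x y = vecForm F m y x := by
  rw [vecForm_apply, vecForm_apply, ← re_star, ← Matrix.star_dotProduct]

theorem vecForm_self (x : Fin m → F) : vecForm F m x x = ∑ i, ‖x i‖ ^ 2 := by
  simp [vecForm_apply, dotProduct, re_sum, re_star_mul_self]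

theorem vecForm_self_pos (x : Fin m → F) (hx : x ≠ 0) : 0 < vecForm F m x x := by
  rw [vecForm_self]
  obtain ⟨i, hi⟩ := Function.ne_iff.1 hx
  have hi' : 0 < ‖x i‖ ^ 2 := by
    have : 0 < ‖x i‖ := norm_pos_iff.2 hi
    positivity
  exact hi'.trans_le (Finset.single_le_sum (f := fun i => ‖x i‖ ^ 2)
    (fun j _ => by positivity) (Finset.mem_univ i))

theorem vecForm_mulVec (A : Matrix (Fin m) (Fin m) F) (x y : Fin m → F) :
    vecForm F m (A *ᵥ x) y = vecForm F m x (Aᴴ *ᵥ y) := by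
  rw [vecForm_apply, vecForm_apply, Matrix.star_mulVec, Matrix.dotProduct_mulVec]

theorem det_nonneg (A : Matrix (Fin m) (Fin m) F) : 0 ≤ det A :=
  Real.rpow_nonneg (abs_nonneg _) _

/-- Multiplications by `A` and `Aᴴ` are adjoint for the form `Re (x* y)`. -/
theorem det_conjTranspose (A : Matrix (Fin m) (Fin m) F) : det Aᴴ = det A := by
  have : LinearMap.det (mulVecReal Aᴴ) = LinearMap.det (mulVecReal A) := by
    refine det_eq_det_of_adjoint (vecForm F m) (fun x hx => ?_) _ _ fun x y => ?_
    · by_contra hne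
      exact (vecForm_self_pos x hne).ne' hx
    · have := vecForm_mulVec Aᴴ x y
      rwa [Matrix.conjTranspose_conjTranspose] at this
  rw [det, this, det]

theorem abs_det_mulVecReal (A : Matrix (Fin m) (Fin m) F) :
    |LinearMap.det (mulVecReal A)| = det A ^ dim F := by
  have hb : (beta F) ≠ 0 := (beta_pos (F := F)).ne'
  rw [det, ← Real.rpow_natCast, ← Real.rpow_mul (abs_nonneg _), one_div, inv_mul_cancel₀ hb,
    Real.rpow_one]

theorem det_one : det (1 : Matrix (Fin m) (Fin m) F) = 1 := by
  have := det_diagonal (F := F) (m := m) (fun _ => 1) (fun _ => zero_le_one)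
  simpa using this

theorem det_pos_of_isUnit {A : Matrix (Fin m) (Fin m) F} (hA : IsUnit A) : 0 < det A := by
  obtain ⟨u, rfl⟩ := hA
  refine (det_nonneg _).lt_of_ne' fun h => ?_
  have h2 := det_mul (u : Matrix (Fin m) (Fin m) F) (u⁻¹ : (Matrix (Fin m) (Fin m) F)ˣ)
  rw [h, zero_mul, Units.mul_inv, det_one] at h2
  exact one_ne_zero h2

/-- Finite real dimension makes the map surjective; preimages of the unit vectors are the columns of
a right inverse, which is also a left inverse. -/
theorem isUnit_of_mulVec_injective {A : Matrix (Fin m) (Fin m) F}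
    (hA : ∀ x, A *ᵥ x = 0 → x = 0) : IsUnit A := by
  have hinj : Function.Injective (mulVecReal A) :=
    (injective_iff_map_eq_zero (mulVecReal A)).2 hA
  have hsurj := LinearMap.injective_iff_surjective.1 hinj
  choose x hx using fun j : Fin m => hsurj (Pi.single j 1)
  have hAX : A * (Matrix.of fun i j => x j i) = 1 := by
    ext i j
    have := congrFun (hx j) i
    rw [Matrix.one_apply]
    rw [Pi.single_apply] at this
    exact this
  exact isUnit_iff_exists.2 ⟨_, hAX, mul_eq_one_symm hAX⟩

theorem PosDef.isUnit {A : Matrix (Fin m) (Fin m) F} (hA : PosDef A) : IsUnit A := by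
  refine isUnit_of_mulVec_injective fun x hx => ?_
  by_contra hne
  have := hA.2 x hne
  rw [hx, dotProduct_zero, re_zero] at this
  exact lt_irrefl _ this

theorem PosDef.det_pos {A : Matrix (Fin m) (Fin m) F} (hA : PosDef A) : 0 < det A :=
  det_pos_of_isUnit hA.isUnit

/-- Congruence by an invertible matrix preserves positive definiteness. -/
theorem PosDef.conj {A B : Matrix (Fin m) (Fin m) F} (hA : PosDef A) (hB : IsUnit B) :
    PosDef (B * A * Bᴴ) := by
  refine ⟨by simp [Matrix.conjTranspose_mul, hA.1, Matrix.mul_assoc], fun x hx => ?_⟩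
  have hne : Bᴴ *ᵥ x ≠ 0 := by
    intro h
    obtain ⟨C, hBC, hCB⟩ := isUnit_iff_exists.1 hB
    apply hx
    have h2 : Cᴴ * Bᴴ = 1 := by rw [← Matrix.conjTranspose_mul, hBC, Matrix.conjTranspose_one]
    rw [← Matrix.one_mulVec x, ← h2, ← Matrix.mulVec_mulVec, h, Matrix.mulVec_zero]
  have := hA.2 _ hne
  rwa [Matrix.star_mulVec, Matrix.conjTranspose_conjTranspose, ← Matrix.dotProduct_mulVec,
    Matrix.mulVec_mulVec, Matrix.mulVec_mulVec] at this

theorem PosDef.inverse {A : Matrix (Fin m) (Fin m) F} (hA : PosDef A) :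
    PosDef (Ring.inverse A) := by
  have h1 := Ring.inverse_mul_cancel A hA.isUnit
  have h2 := Ring.mul_inverse_cancel A hA.isUnit
  have hH : (Ring.inverse A)ᴴ = Ring.inverse A := by
    have h3 : (Ring.inverse A)ᴴ * A = 1 := by
      have := congrArg Matrix.conjTranspose h2
      rwa [Matrix.conjTranspose_mul, hA.1, Matrix.conjTranspose_one] at this
    calc (Ring.inverse A)ᴴ = (Ring.inverse A)ᴴ * (A * Ring.inverse A) := by rw [h2, mul_one]
      _ = Ring.inverse A := by rw [← mul_assoc, h3, one_mul]
  have hu : IsUnit (Ring.inverse A) := isUnit_iff_exists.2 ⟨A, h1, h2⟩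
  have := hA.conj hu
  rwa [hH, h1, one_mul] at this

/-- The sum of a positive definite matrix and of a congruence transform of another one. -/
theorem PosDef.add_conj {n : ℕ} {A : Matrix (Fin m) (Fin m) F} {C : Matrix (Fin n) (Fin n) F}
    (hA : PosDef A) (hC : PosDef C) (X : Matrix (Fin m) (Fin n) F) :
    PosDef (A + X * C * Xᴴ) := by
  refine ⟨by simp [Matrix.conjTranspose_mul, hA.1, hC.1, Matrix.mul_assoc], fun x hx => ?_⟩
  rw [Matrix.add_mulVec, dotProduct_add, re_add]
  refine add_pos_of_pos_of_nonneg (hA.2 x hx) ?_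
  have h : star x ⬝ᵥ ((X * C * Xᴴ) *ᵥ x) = star (Xᴴ *ᵥ x) ⬝ᵥ (C *ᵥ (Xᴴ *ᵥ x)) := by
    rw [Matrix.star_mulVec, Matrix.conjTranspose_conjTranspose, ← Matrix.dotProduct_mulVec,
      Matrix.mulVec_mulVec, Matrix.mulVec_mulVec]
  rw [h]
  rcases eq_or_ne (Xᴴ *ᵥ x) 0 with h0 | h0
  · rw [h0]; simp [re_zero]
  · exact (hC.2 _ h0).le

end Algebra

/-! ### The spectral theorem over `F`. -/

section Spectral

/-- The real diagonal matrix with entries `d i`. -/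
noncomputable def realDiagonal (F : Type*) [NormedDivisionRing F] [NormedAlgebra ℝ F]
    {m : ℕ} (d : Fin m → ℝ) : Matrix (Fin m) (Fin m) F :=
  Matrix.diagonal fun i => algebraMap ℝ F (d i)

theorem realDiagonal_mul {F : Type*} [NormedDivisionRing F] [NormedAlgebra ℝ F] {m : ℕ}
    (d e : Fin m → ℝ) :
    realDiagonal F d * realDiagonal F e = realDiagonal F fun i => d i * e i := by
  simp [realDiagonal]

variable {F : Type*} [NormedDivisionRing F] [NormedAlgebra ℝ F] [StarRing F]
  [RealNormedDivisionAlgebra F] {m : ℕ}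

theorem star_dotProduct_self (x : Fin m → F) :
    star x ⬝ᵥ x = algebraMap ℝ F (vecForm F m x x) := by
  simp [vecForm_self, dotProduct, RealNormedDivisionAlgebra.star_mul_self_eq]

theorem star_smul_vec (r : ℝ) (x : Fin m → F) : star (r • x) = r • star x :=
  funext fun i => star_smul_real r (x i)

/-- A Hermitian matrix has orthonormal systems of eigenvectors of every size up to `m`. -/
theorem exists_orthonormal_eigenvectors {A : Matrix (Fin m) (Fin m) F} (hA : Aᴴ = A) :
    ∀ k ≤ m, ∃ (w : Fin k → Fin m → F) (l : Fin k → ℝ),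
      (∀ i j, star (w i) ⬝ᵥ w j = if i = j then 1 else 0) ∧ ∀ i, A *ᵥ w i = l i • w i := by
  intro k
  induction k with
  | zero => exact fun _ => ⟨Fin.elim0, Fin.elim0, fun i => i.elim0, fun i => i.elim0⟩
  | succ k ih =>
    intro hk
    obtain ⟨w, l, hw, hl⟩ := ih (by omega)
    -- The kernel is the `F`-valued orthogonal complement of the vectors found so far. It is nonzero
    -- because `k < m`, and `A` preserves it because `A` is Hermitian.
    let f : (Fin m → F) →ₗ[ℝ] (Fin k → F) :=
      { toFun := fun x i => star (w i) ⬝ᵥ x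
        map_add' := fun x y => by ext i; simp
        map_smul' := fun r x => by ext i; simp }
    have hker : f.ker ≠ ⊥ := by
      apply LinearMap.ker_ne_bot_of_finrank_lt
      have h1 : 0 < Module.finrank ℝ F := Module.finrank_pos
      simp only [Module.finrank_pi_fintype, Finset.sum_const, Finset.card_univ, Fintype.card_fin,
        smul_eq_mul]
      exact Nat.mul_lt_mul_of_pos_right (by omega) h1
    have : Nontrivial f.ker := Submodule.nontrivial_iff_ne_bot.2 hker
    have hmem : ∀ x, x ∈ f.ker ↔ ∀ i, star (w i) ⬝ᵥ x = 0 := fun x => by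
      rw [LinearMap.mem_ker, funext_iff]; rfl
    have hinv : ∀ x ∈ f.ker, mulVecReal A x ∈ f.ker := by
      intro x hx
      rw [hmem] at hx ⊢
      intro i
      have h1 : star (w i) ⬝ᵥ (A *ᵥ x) = star (A *ᵥ w i) ⬝ᵥ x := by
        rw [Matrix.star_mulVec, hA, Matrix.dotProduct_mulVec]
      change star (w i) ⬝ᵥ (A *ᵥ x) = 0
      rw [h1, hl, star_smul_vec, smul_dotProduct, hx i, smul_zero]
    -- Working over `ℝ` yields a real eigenvalue, which is central in `F`, so left and right
    -- eigenvalues need not be distinguished.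
    obtain ⟨r, ⟨x, hxU⟩, hx0, hx⟩ := exists_eigenvector_of_selfAdjoint
      ((vecForm F m).compl₁₂ f.ker.subtype f.ker.subtype)
      (fun x y => vecForm_symm _ _)
      (fun x hx => vecForm_self_pos _ (by simpa using hx))
      ((mulVecReal A).restrict hinv)
      (fun x y => by
        have := vecForm_mulVec A x.1 y.1
        rwa [hA] at this)
    have hx0' : x ≠ 0 := fun h => hx0 (Subtype.ext h)
    have hAx : A *ᵥ x = r • x := congrArg Subtype.val hx
    rw [hmem] at hxU
    have hq := vecForm_self_pos x hx0'
    set q := vecForm F m x x with hqdef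
    let y : Fin m → F := (Real.sqrt q)⁻¹ • x
    have hyy : star y ⬝ᵥ y = 1 := by
      simp only [y, star_smul_vec, smul_dotProduct, dotProduct_smul]
      rw [star_dotProduct_self, ← hqdef, smul_smul, Algebra.algebraMap_eq_smul_one, smul_smul,
        ← mul_inv, Real.mul_self_sqrt hq.le, inv_mul_cancel₀ hq.ne', one_smul]
    have hwy : ∀ i, star (w i) ⬝ᵥ y = 0 := fun i => by
      simp only [y, dotProduct_smul, hxU i, smul_zero]
    have hyw : ∀ i, star y ⬝ᵥ w i = 0 := fun i => by
      rw [Matrix.star_dotProduct, hwy i, star_zero]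
    refine ⟨Fin.snoc w y, Fin.snoc l r, fun i j => ?_, fun i => ?_⟩
    · refine Fin.lastCases ?_ (fun i => ?_) i <;> refine Fin.lastCases ?_ (fun j => ?_) j
      · simpa using hyy
      · simpa [Fin.ext_iff, j.2.ne'] using hyw j
      · simpa [Fin.ext_iff, i.2.ne] using hwy i
      · simpa using hw i j
    · refine Fin.lastCases ?_ (fun i => ?_) i
      · simp only [Fin.snoc_last, y]
        rw [Matrix.mulVec_smul, hAx, smul_comm]
      · simpa using hl i

theorem conjTranspose_realDiagonal (d : Fin m → ℝ) :
    (realDiagonal F d)ᴴ = realDiagonal F d := by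
  rw [realDiagonal, Matrix.diagonal_conjTranspose]
  congr 1
  exact funext fun i => star_algebraMap (d i)

/-- The spectral theorem for positive definite matrices. -/
theorem PosDef.exists_spectral {A : Matrix (Fin m) (Fin m) F} (hA : PosDef A) :
    ∃ (W : Matrix (Fin m) (Fin m) F) (d : Fin m → ℝ),
      W * Wᴴ = 1 ∧ (∀ i, 0 < d i) ∧ A = Wᴴ * realDiagonal F d * W := by
  obtain ⟨w, l, hw, hl⟩ := exists_orthonormal_eigenvectors hA.1 m le_rfl
  -- The columns of `Wᴴ` are the eigenvectors.
  let W : Matrix (Fin m) (Fin m) F := Matrix.of fun i j => star (w i j)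
  have hW : W * Wᴴ = 1 := by
    ext i j
    rw [Matrix.one_apply, ← hw i j]
    simp [W, Matrix.mul_apply, dotProduct]
  have hW' : Wᴴ * W = 1 := mul_eq_one_symm hW
  refine ⟨W, l, hW, fun i => ?_, ?_⟩
  · have hne : w i ≠ 0 := by
      intro h
      have := hw i i
      simp [h] at this
    have h1 := hA.2 _ hne
    rw [hl, dotProduct_smul, hw, if_pos rfl, re_smul] at h1
    have h2 := re_algebraMap (F := F) 1
    rw [map_one] at h2
    rwa [h2, mul_one] at h1
  · have h1 : A * Wᴴ = Wᴴ * realDiagonal F l := by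
      ext i j
      rw [realDiagonal, Matrix.mul_diagonal]
      have := congrFun (hl j) i
      simp only [Matrix.mulVec, dotProduct, Pi.smul_apply] at this
      simp only [Matrix.mul_apply, W, Matrix.conjTranspose_apply, Matrix.of_apply, star_star]
      rw [this, Algebra.smul_def, Algebra.commutes]
    rw [← h1, Matrix.mul_assoc, hW', Matrix.mul_one]

/-- A positive definite matrix factors as `Bᴴ * B`, with `B` the product of a real positive
diagonal matrix and of a unitary matrix. -/
theorem PosDef.exists_factorization {A : Matrix (Fin m) (Fin m) F} (hA : PosDef A) :
    ∃ (W : Matrix (Fin m) (Fin m) F) (d : Fin m → ℝ),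
      W * Wᴴ = 1 ∧ (∀ i, 0 < d i) ∧ A = (realDiagonal F d * W)ᴴ * (realDiagonal F d * W) := by
  obtain ⟨W, d, hW, hd, rfl⟩ := hA.exists_spectral
  refine ⟨W, fun i => Real.sqrt (d i), hW, fun i => Real.sqrt_pos.2 (hd i), ?_⟩
  have h : realDiagonal F d =
      realDiagonal F (fun i => Real.sqrt (d i)) * realDiagonal F (fun i => Real.sqrt (d i)) := by
    rw [realDiagonal_mul]
    congr 1
    exact funext fun i => (Real.mul_self_sqrt (hd i).le).symm
  rw [Matrix.conjTranspose_mul, conjTranspose_realDiagonal, h]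
  simp only [Matrix.mul_assoc]

end Spectral

/-! ### The Jacobian of a congruence on Hermitian matrices. -/

section Hermitian

variable {F : Type*} [NormedDivisionRing F] [NormedAlgebra ℝ F] [StarRing F]
  [RealNormedDivisionAlgebra F] {m : ℕ}

variable (F m) in
/-- The real coordinates of Hermitian `m × m` matrices. -/
abbrev HermitianCoord : Type :=
  (Fin m → ℝ) × ({p : Fin m × Fin m // p.1 < p.2} → Fin (dim F) → ℝ)

variable (F) in
/-- The coordinates of `F` as a linear equivalence. -/
noncomputable def coordEquiv : (Fin (dim F) → ℝ) ≃ₗ[ℝ] F :=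
  (RealNormedDivisionAlgebra.basis (F := F)).equivFun.symm

theorem coordEquiv_apply (c : Fin (dim F) → ℝ) : coordEquiv F c = ofCoord c := by
  simp [coordEquiv, ofCoord, Module.Basis.equivFun_symm_apply]

theorem algebraMap_re_of_star_eq {x : F} (hx : star x = x) : algebraMap ℝ F (re x) = x := by
  have h := add_star_eq x
  rw [hx, two_mul, map_add] at h
  have h2 : (2 : ℝ) • algebraMap ℝ F (re x) = (2 : ℝ) • x := by rw [two_smul, two_smul, h]
  exact smul_right_injective F (two_ne_zero (α := ℝ)) h2

variable (F m) in
/-- `hermitianOfCoord` as a linear map. -/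
noncomputable def hermitianLinear : HermitianCoord F m →ₗ[ℝ] Matrix (Fin m) (Fin m) F where
  toFun := hermitianOfCoord
  map_add' c c' := by
    ext i j
    simp only [hermitianOfCoord, Matrix.of_apply, Matrix.add_apply, ← coordEquiv_apply]
    split_ifs <;> simp [map_add]
  map_smul' r c := by
    ext i j
    simp only [hermitianOfCoord, Matrix.of_apply, Matrix.smul_apply, ← coordEquiv_apply]
    split_ifs
    · simp
    · simp [star_smul_real]
    · simp [Algebra.smul_def]

variable (F m) in
/-- The coordinates of the Hermitian matrix with given upper triangular part. -/
noncomputable def hermitianRepr : Matrix (Fin m) (Fin m) F →ₗ[ℝ] HermitianCoord F m where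
  toFun A := (fun i => re (A i i), fun p => (coordEquiv F).symm (A p.1.1 p.1.2))
  map_add' A B := by ext <;> simp [re_add]
  map_smul' r A := by ext <;> simp [re_smul]

theorem hermitianRepr_hermitianOfCoord (c : HermitianCoord F m) :
    hermitianRepr F m (hermitianOfCoord c) = c := by
  refine Prod.ext (funext fun i => ?_) (funext fun p => ?_)
  · simp [hermitianRepr, hermitianOfCoord, re_algebraMap]
  · simp [hermitianRepr, hermitianOfCoord, p.2, ← coordEquiv_apply]

theorem hermitianOfCoord_hermitianRepr {A : Matrix (Fin m) (Fin m) F} (hA : Aᴴ = A) :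
    hermitianOfCoord (hermitianRepr F m A) = A := by
  ext i j
  have hs : ∀ i j, star (A j i) = A i j := fun i j => congrFun (congrFun hA i) j
  simp only [hermitianOfCoord, hermitianRepr, LinearMap.coe_mk, AddHom.coe_mk, Matrix.of_apply,
    ← coordEquiv_apply, LinearEquiv.apply_symm_apply]
  split_ifs with h1 h2
  · rfl
  · exact hs i j
  · obtain rfl : i = j := le_antisymm (not_lt.1 h2) (not_lt.1 h1)
    exact algebraMap_re_of_star_eq (hs i i)

theorem conjTranspose_hermitianOfCoord (c : HermitianCoord F m) :
    (hermitianOfCoord c)ᴴ = hermitianOfCoord (F := F) c := by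
  ext i j
  simp only [hermitianOfCoord, Matrix.conjTranspose_apply, Matrix.of_apply]
  rcases lt_trichotomy i j with h | rfl | h
  · simp [h, h.not_gt]
  · simp [star_algebraMap]
  · simp [h, h.not_gt]

theorem hermitianOfCoord_injective :
    Function.Injective (hermitianOfCoord : HermitianCoord F m → Matrix (Fin m) (Fin m) F) :=
  Function.LeftInverse.injective hermitianRepr_hermitianOfCoord

/-- The congruence `X ↦ B X Bᴴ` in the coordinates of Hermitian matrices. -/
noncomputable def congruence (B : Matrix (Fin m) (Fin m) F) :
    HermitianCoord F m →ₗ[ℝ] HermitianCoord F m where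
  toFun c := hermitianRepr F m (B * hermitianLinear F m c * Bᴴ)
  map_add' c c' := by simp [Matrix.mul_add, Matrix.add_mul]
  map_smul' r c := by simp

theorem hermitianOfCoord_congruence (B : Matrix (Fin m) (Fin m) F) (c : HermitianCoord F m) :
    hermitianOfCoord (congruence B c) = B * hermitianOfCoord c * Bᴴ := by
  refine hermitianOfCoord_hermitianRepr ?_
  change (B * hermitianOfCoord c * Bᴴ)ᴴ = B * hermitianOfCoord c * Bᴴ
  simp [Matrix.conjTranspose_mul, conjTranspose_hermitianOfCoord, Matrix.mul_assoc]

theorem congruence_mul (B C : Matrix (Fin m) (Fin m) F) :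
    congruence (B * C) = congruence B ∘ₗ congruence C := by
  refine LinearMap.ext fun c => hermitianOfCoord_injective ?_
  simp only [LinearMap.comp_apply, hermitianOfCoord_congruence, Matrix.conjTranspose_mul,
    Matrix.mul_assoc]

theorem congruence_one : congruence (1 : Matrix (Fin m) (Fin m) F) = LinearMap.id := by
  refine LinearMap.ext fun c => hermitianOfCoord_injective ?_
  simp [hermitianOfCoord_congruence]

theorem re_trace_conjTranspose_mul_self {ι κ : Type*} [Fintype ι] [Fintype κ]
    (A : Matrix ι κ F) : re (Aᴴ * A).trace = ∑ j, ∑ i, ‖A i j‖ ^ 2 := by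
  simp [Matrix.trace, Matrix.mul_apply, re_sum, re_star_mul_self]

variable (F m) in
/-- The inner product `Re tr (X Y)` of Hermitian matrices in coordinates. -/
noncomputable def hermitianForm :
    HermitianCoord F m →ₗ[ℝ] HermitianCoord F m →ₗ[ℝ] ℝ :=
  LinearMap.mk₂ ℝ
    (fun c c' => re (hermitianLinear F m c * hermitianLinear F m c').trace)
    (fun c c' e => by simp [Matrix.add_mul, re_add])
    (fun r c e => by simp [re_smul])
    (fun c e e' => by simp [Matrix.mul_add, re_add])
    (fun r c e => by simp [re_smul])

theorem hermitianForm_apply (c c' : HermitianCoord F m) :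
    hermitianForm F m c c' =
      re (hermitianOfCoord (F := F) c * hermitianOfCoord (F := F) c').trace := rfl

theorem hermitianForm_definite (c : HermitianCoord F m) (hc : hermitianForm F m c c = 0) :
    c = 0 := by
  rw [hermitianForm_apply] at hc
  nth_rw 1 [← conjTranspose_hermitianOfCoord] at hc
  rw [re_trace_conjTranspose_mul_self, Finset.sum_eq_zero_iff_of_nonneg
    (fun _ _ => Finset.sum_nonneg fun _ _ => by positivity)] at hc
  refine hermitianOfCoord_injective ((?_ : hermitianOfCoord (F := F) c = 0).trans
    (map_zero (hermitianLinear F m)).symm)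
  ext i j
  have h1 := hc j (Finset.mem_univ j)
  rw [Finset.sum_eq_zero_iff_of_nonneg (fun _ _ => by positivity)] at h1
  have h2 := h1 i (Finset.mem_univ i)
  simpa using h2

/-- For the form `Re tr (X Y)` the adjoint of `X ↦ B X Bᴴ` is `X ↦ Bᴴ X B`, by cyclicity. -/
theorem det_congruence_conjTranspose (B : Matrix (Fin m) (Fin m) F) :
    LinearMap.det (congruence Bᴴ) = LinearMap.det (congruence B) := by
  refine det_eq_det_of_adjoint (hermitianForm F m) hermitianForm_definite _ _ fun c c' => ?_
  rw [hermitianForm_apply, hermitianForm_apply, hermitianOfCoord_congruence,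
    hermitianOfCoord_congruence, Matrix.conjTranspose_conjTranspose, Matrix.mul_assoc,
    Matrix.mul_assoc, re_trace_mul_comm]
  simp only [Matrix.mul_assoc]

/-- The congruences by `W` and `Wᴴ` are mutually inverse with equal determinants, so this
determinant squares to one. -/
theorem abs_det_congruence_unitary {W : Matrix (Fin m) (Fin m) F} (hW : W * Wᴴ = 1) :
    |LinearMap.det (congruence W)| = 1 := by
  have h : LinearMap.det (congruence (W * Wᴴ)) = 1 := by
    rw [hW, congruence_one, LinearMap.det_id]
  rw [congruence_mul, LinearMap.det_comp, det_congruence_conjTranspose] at h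
  have := congrArg abs h
  rw [abs_mul, abs_one] at this
  nlinarith [abs_nonneg (LinearMap.det (congruence W))]

/-- Each index belongs to exactly `m - 1` unordered pairs of distinct indices. -/
theorem prod_lt_mul (d : Fin m → ℝ) :
    ∏ p : {p : Fin m × Fin m // p.1 < p.2}, d p.1.1 * d p.1.2 = (∏ i, d i) ^ (m - 1) := by
  have h1 : ∏ p : {p : Fin m × Fin m // p.1 < p.2}, d p.1.1 * d p.1.2 =
      ∏ i, ∏ j, if i < j then d i * d j else 1 := by
    rw [← Fintype.prod_prod_type' (f := fun i j => if i < j then d i * d j else 1),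
      ← Finset.prod_filter, Finset.prod_subtype (p := fun p : Fin m × Fin m => p.1 < p.2)]
    simp
  have h2 : ∏ i, ∏ j, (if i < j then d i * d j else 1) =
      (∏ i, ∏ j, if i < j then d i else 1) * ∏ i, ∏ j, if j < i then d i else 1 := by
    rw [Finset.prod_comm (f := fun i j => if j < i then d i else 1)]
    simp only [← Finset.prod_mul_distrib]
    refine Finset.prod_congr rfl fun i _ => Finset.prod_congr rfl fun j _ => ?_
    split_ifs <;> simp
  rw [h1, h2, ← Finset.prod_mul_distrib, ← Finset.prod_pow]
  refine Finset.prod_congr rfl fun i _ => ?_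
  rw [← Finset.prod_mul_distrib]
  have h3 : ∀ j, ((if i < j then d i else 1) * if j < i then d i else 1) =
      if j ≠ i then d i else 1 := by
    intro j
    rcases lt_trichotomy i j with h | rfl | h
    · simp [h, h.not_gt, h.ne']
    · simp
    · simp [h, h.not_gt, h.ne]
  rw [Finset.prod_congr rfl fun j _ => h3 j, ← Finset.prod_filter, Finset.prod_const,
    Finset.filter_ne', Finset.card_erase_of_mem (Finset.mem_univ i), Finset.card_univ,
    Fintype.card_fin]

/-- The congruence is diagonal in coordinates: `sᵢᵢ` is scaled by `dᵢ²`, and each of the `β`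
coordinates of `sᵢⱼ` by `dᵢ dⱼ`. -/
theorem det_congruence_realDiagonal (d : Fin m → ℝ) :
    LinearMap.det (congruence (realDiagonal F d)) =
      (∏ i, d i) ^ (2 + (m - 1) * dim F) := by
  have h : congruence (realDiagonal F d) = LinearMap.prodMap
      (LinearMap.pi fun i => (d i ^ 2 • LinearMap.id) ∘ₗ LinearMap.proj i)
      (LinearMap.pi fun p => ((d p.1.1 * d p.1.2) • LinearMap.id) ∘ₗ LinearMap.proj p) := by
    refine LinearMap.ext fun c => ?_
    have hent : ∀ i j, (realDiagonal F d * hermitianOfCoord c * (realDiagonal F d)ᴴ) i j =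
        (d i * d j) • hermitianOfCoord (F := F) c i j := by
      intro i j
      rw [conjTranspose_realDiagonal, realDiagonal, Matrix.mul_diagonal, Matrix.diagonal_mul,
        ← Algebra.commutes, ← Algebra.smul_def, ← Algebra.smul_def, smul_smul, mul_comm]
    refine Prod.ext (funext fun i => ?_) (funext fun p => ?_)
    · change re ((realDiagonal F d * hermitianOfCoord c * (realDiagonal F d)ᴴ) i i) = _
      rw [hent, re_smul]
      simp [hermitianOfCoord, re_algebraMap, sq]
    · change (coordEquiv F).symm
        ((realDiagonal F d * hermitianOfCoord c * (realDiagonal F d)ᴴ) p.1.1 p.1.2) = _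
      rw [hent, map_smul]
      simp [hermitianOfCoord, p.2, ← coordEquiv_apply]
  rw [h, LinearMap.det_prodMap, LinearMap.det_pi, LinearMap.det_pi]
  simp only [LinearMap.det_smul, LinearMap.det_id, mul_one, Module.finrank_self, pow_one,
    Module.finrank_pi, Fintype.card_fin, Finset.prod_pow]
  rw [prod_lt_mul, pow_add, pow_mul]

theorem abs_det_congruence {W : Matrix (Fin m) (Fin m) F} (hW : W * Wᴴ = 1) {d : Fin m → ℝ}
    (hd : ∀ i, 0 < d i) :
    |LinearMap.det (congruence (realDiagonal F d * W))| =
      det (realDiagonal F d * W) ^ (2 + ((m : ℝ) - 1) * beta F) := by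
  have hdW : det W = 1 := by
    have h := det_mul W Wᴴ
    rw [hW, det_one, det_conjTranspose] at h
    nlinarith [det_nonneg W]
  have hdet : det (realDiagonal F d * W) = ∏ i, d i := by
    rw [det_mul, hdW, mul_one, realDiagonal, det_diagonal d fun i => (hd i).le]
  have hprod : 0 < ∏ i, d i := Finset.prod_pos fun i _ => hd i
  rw [congruence_mul, LinearMap.det_comp, abs_mul, abs_det_congruence_unitary hW, mul_one,
    det_congruence_realDiagonal, abs_of_pos (pow_pos hprod _), hdet]
  -- For `m = 0` the truncated `m - 1` and the real `m - 1` differ, but the base is an empty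
  -- product.
  rcases m with _ | m
  · simp
  · rw [← Real.rpow_natCast]
    congr 1
    simp

end Hermitian

/-! ### Continuity and measurability of the matrix operations. -/

section Topology

variable {F : Type*} [NormedDivisionRing F] [NormedAlgebra ℝ F] [StarRing F]
  [RealNormedDivisionAlgebra F] {m n : ℕ}

instance instProperSpace : ProperSpace F := FiniteDimensional.proper_real F

theorem continuous_re : Continuous (re : F → ℝ) :=
  (reLinear F).continuous_of_finiteDimensional

instance instContinuousStar : ContinuousStar F where
  continuous_star := by
    have h : (star : F → F) = fun x => algebraMap ℝ F (2 * re x) - x :=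
      funext fun x => by rw [← add_star_eq, add_sub_cancel_left]
    rw [h]
    exact ((continuous_algebraMap ℝ F).comp (continuous_const.mul continuous_re)).sub continuous_id

instance instSecondCountableTopologyMatrix {ι κ : Type*} [Countable ι] [Countable κ] :
    SecondCountableTopology (Matrix ι κ F) :=
  inferInstanceAs (SecondCountableTopology (ι → κ → F))

instance instBorelSpaceMatrix {ι κ : Type*} [Countable ι] [Countable κ] [MeasurableSpace F]
    [BorelSpace F] : BorelSpace (Matrix ι κ F) :=
  inferInstanceAs (BorelSpace (ι → κ → F))

variable (F m) in
/-- The real basis of `F ^ m`. -/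
noncomputable def vecBasis : Module.Basis (Σ _ : Fin m, Fin (dim F)) ℝ (Fin m → F) :=
  Pi.basis fun _ => RealNormedDivisionAlgebra.basis (F := F)

/-- The real matrix of `x ↦ A x`. -/
noncomputable def realMatrix (A : Matrix (Fin m) (Fin m) F) :
    Matrix (Σ _ : Fin m, Fin (dim F)) (Σ _ : Fin m, Fin (dim F)) ℝ :=
  LinearMap.toMatrix (vecBasis F m) (vecBasis F m) (mulVecReal A)

theorem continuous_realMatrix :
    Continuous (realMatrix : Matrix (Fin m) (Fin m) F → _) := by
  refine continuous_matrix fun i j => ?_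
  simp only [realMatrix, LinearMap.toMatrix_apply]
  exact ((vecBasis F m).coord i).continuous_of_finiteDimensional.comp
    (continuous_id.matrix_mulVec continuous_const)

theorem continuous_det : Continuous (det : Matrix (Fin m) (Fin m) F → ℝ) := by
  have h : ∀ A : Matrix (Fin m) (Fin m) F,
      LinearMap.det (mulVecReal A) = (realMatrix A).det := fun A =>
    (LinearMap.det_toMatrix (vecBasis F m) (mulVecReal A)).symm
  have h2 : (det : Matrix (Fin m) (Fin m) F → ℝ) =
      fun A => |(realMatrix A).det| ^ (1 / beta F) := funext fun A => by rw [det, h]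
  rw [h2]
  exact (continuous_realMatrix.matrix_det.abs).rpow_const
    fun _ => Or.inr (by positivity)

theorem realMatrix_inverse {A : Matrix (Fin m) (Fin m) F} (hA : IsUnit A) :
    realMatrix (Ring.inverse A) = (realMatrix A)⁻¹ := by
  refine (Matrix.inv_eq_left_inv ?_).symm
  rw [realMatrix, realMatrix, ← LinearMap.toMatrix_comp]
  have : mulVecReal (Ring.inverse A) ∘ₗ mulVecReal A = LinearMap.id := by
    refine LinearMap.ext fun x => ?_
    simp [mulVecReal, Ring.inverse_mul_cancel A hA]
  rw [this, LinearMap.toMatrix_id]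

/-- The matrix over `F` recovered from the real matrix of `x ↦ A x`. -/
noncomputable def ofRealMatrix
    (M : Matrix (Σ _ : Fin m, Fin (dim F)) (Σ _ : Fin m, Fin (dim F)) ℝ) :
    Matrix (Fin m) (Fin m) F :=
  Matrix.of fun i j => Matrix.toLin (vecBasis F m) (vecBasis F m) M (Pi.single j 1) i

theorem ofRealMatrix_realMatrix (A : Matrix (Fin m) (Fin m) F) :
    ofRealMatrix (realMatrix A) = A := by
  ext i j
  simp [ofRealMatrix, realMatrix, mulVecReal]

theorem continuous_ofRealMatrix :
    Continuous (ofRealMatrix (F := F) (m := m)) := by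
  refine continuous_matrix fun i j => ?_
  simp only [ofRealMatrix, Matrix.of_apply, Matrix.toLin_apply]
  have h : Continuous fun M : Matrix (Σ _ : Fin m, Fin (dim F)) (Σ _ : Fin m, Fin (dim F)) ℝ =>
      ∑ k, (M *ᵥ (vecBasis F m).repr (Pi.single j 1)) k • vecBasis F m k :=
    continuous_finsetSum _ fun k _ => Continuous.smul
      ((continuous_apply k).comp (continuous_id.matrix_mulVec continuous_const)) continuous_const
  exact (continuous_apply i).comp h

/-- The adjugate formula for the real matrix of `x ↦ A x` is measurable everywhere; only its values
at invertible `A` matter. -/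
theorem exists_measurable_inverse [MeasurableSpace F] [BorelSpace F] :
    ∃ f : Matrix (Fin m) (Fin m) F → Matrix (Fin m) (Fin m) F, Measurable f ∧
      ∀ A, IsUnit A → f A = Ring.inverse A := by
  refine ⟨fun A => ofRealMatrix ((realMatrix A).det⁻¹ • (realMatrix A).adjugate), ?_,
    fun A hA => ?_⟩
  · have h1 : Measurable fun A : Matrix (Fin m) (Fin m) F =>
        (realMatrix A).det⁻¹ • (realMatrix A).adjugate := by
      refine measurable_pi_iff.2 fun i => measurable_pi_iff.2 fun j => ?_
      exact continuous_realMatrix.matrix_det.measurable.inv.mul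
        (continuous_realMatrix.matrix_adjugate.matrix_elem i j).measurable
    exact continuous_ofRealMatrix.measurable.comp h1
  · rw [← ofRealMatrix_realMatrix (Ring.inverse A), realMatrix_inverse hA, Matrix.inv_def,
      Ring.inverse_eq_inv']

/-- By homogeneity, positivity need only be tested on the unit sphere. Compactness of the sphere
makes that condition open, while being Hermitian is closed. -/
theorem measurableSet_posDef [MeasurableSpace F] [BorelSpace F] :
    MeasurableSet {A : Matrix (Fin m) (Fin m) F | PosDef A} := by
  have h : {A : Matrix (Fin m) (Fin m) F | PosDef A} = {A | Aᴴ = A} ∩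
      {A | ∀ x ∈ Metric.sphere (0 : Fin m → F) 1, 0 < re (star x ⬝ᵥ (A *ᵥ x))} := by
    ext A
    refine and_congr_right fun _ => ⟨fun h x hx => h x ?_, fun h x hx => ?_⟩
    · rintro rfl
      simp at hx
    · have hn : 0 < ‖x‖ := norm_pos_iff.2 hx
      have := h (‖x‖⁻¹ • x) (by
        rw [mem_sphere_zero_iff_norm, norm_smul, norm_inv, norm_norm, inv_mul_cancel₀ hn.ne'])
      rw [star_smul_vec, Matrix.mulVec_smul, smul_dotProduct, dotProduct_smul, re_smul,
        re_smul] at this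
      have h2 : 0 < ‖x‖⁻¹ := by positivity
      exact pos_of_mul_pos_right (pos_of_mul_pos_right this h2.le) h2.le
  rw [h]
  refine (isClosed_eq continuous_id.matrix_conjTranspose continuous_id).measurableSet.inter
    (IsOpen.measurableSet ?_)
  rw [isOpen_iff_mem_nhds]
  intro A hA
  refine (isCompact_sphere (0 : Fin m → F) 1).eventually_forall_of_forall_eventually
    fun x hx => ?_
  have hc : Continuous fun z : Matrix (Fin m) (Fin m) F × (Fin m → F) =>
      re (star z.2 ⬝ᵥ (z.1 *ᵥ z.2)) :=
    continuous_re.comp (continuous_snd.star.dotProduct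
      (continuous_fst.matrix_mulVec continuous_snd))
  exact hc.continuousAt.eventually (lt_mem_nhds (hA x hx))

end Topology

/-! ### Linear changes of variables for the Lebesgue measures. -/

section Measure

instance instIsAddHaarMeasureVolumePi {ι E : Type*} [Fintype ι] [NormedAddCommGroup E]
    [NormedSpace ℝ E] [MeasureSpace E] [BorelSpace E] [FiniteDimensional ℝ E]
    [(volume : Measure E).IsAddHaarMeasure] : (volume : Measure (ι → E)).IsAddHaarMeasure := by
  have : ProperSpace E := FiniteDimensional.proper_real E
  exact inferInstanceAs (Measure.pi fun _ : ι => (volume : Measure E)).IsAddHaarMeasure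

instance instIsAddHaarMeasureVolumeProd {E E' : Type*} [NormedAddCommGroup E] [NormedSpace ℝ E]
    [MeasureSpace E] [BorelSpace E] [FiniteDimensional ℝ E]
    [(volume : Measure E).IsAddHaarMeasure] [NormedAddCommGroup E'] [NormedSpace ℝ E']
    [MeasureSpace E'] [BorelSpace E'] [FiniteDimensional ℝ E']
    [(volume : Measure E').IsAddHaarMeasure] :
    (volume : Measure (E × E')).IsAddHaarMeasure := by
  have : ProperSpace E := FiniteDimensional.proper_real E
  have : ProperSpace E' := FiniteDimensional.proper_real E'
  exact inferInstanceAs ((volume : Measure E).prod (volume : Measure E')).IsAddHaarMeasure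

/-- The change of variables formula for an invertible linear map and a Haar measure. -/
theorem lintegral_map_linearMap {E : Type*} [NormedAddCommGroup E] [NormedSpace ℝ E]
    [FiniteDimensional ℝ E] [MeasurableSpace E] [BorelSpace E] (μ : Measure E)
    [μ.IsAddHaarMeasure] (f : E →ₗ[ℝ] E) (hf : LinearMap.det f ≠ 0) {h : E → ENNReal}
    (hh : Measurable h) :
    ∫⁻ x, h x ∂μ = ENNReal.ofReal |LinearMap.det f| * ∫⁻ x, h (f x) ∂μ := by
  have hm : Measurable f := f.continuous_of_finiteDimensional.measurable
  rw [← lintegral_map hh hm, Measure.map_linearMap_addHaar_eq_smul_addHaar μ hf,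
    lintegral_smul_measure, smul_eq_mul, ← mul_assoc, ← ENNReal.ofReal_mul (abs_nonneg _),
    abs_inv, mul_inv_cancel₀ (abs_ne_zero.2 hf), ENNReal.ofReal_one, one_mul]

variable {F : Type*} [NormedDivisionRing F] [NormedAlgebra ℝ F] [StarRing F]
  [RealNormedDivisionAlgebra F] {m n : ℕ}

variable (F m n) in
/-- The real coordinates of `m × n` matrices as a linear equivalence. -/
noncomputable def matrixCoordEquiv :
    (Fin m → Fin n → Fin (dim F) → ℝ) ≃ₗ[ℝ] Matrix (Fin m) (Fin n) F :=
  (LinearEquiv.piCongrRight fun _ => LinearEquiv.piCongrRight fun _ => coordEquiv F).trans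
    (Matrix.ofLinearEquiv ℝ)

theorem matrixCoordEquiv_apply (c : Fin m → Fin n → Fin (dim F) → ℝ) :
    matrixCoordEquiv F m n c = Matrix.of fun i j => ofCoord (c i j) := by
  ext i j
  exact coordEquiv_apply (c i j)

/-- Left multiplication as a real-linear endomorphism. -/
def mulLeftReal (n : ℕ) (L : Matrix (Fin m) (Fin m) F) :
    Matrix (Fin m) (Fin n) F →ₗ[ℝ] Matrix (Fin m) (Fin n) F where
  toFun X := L * X
  map_add' X Y := Matrix.mul_add L X Y
  map_smul' r X := by simp

/-- Left multiplication acts separately on each of the `n` columns. -/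
theorem det_mulLeftReal (L : Matrix (Fin m) (Fin m) F) :
    LinearMap.det (mulLeftReal n L) = LinearMap.det (mulVecReal L) ^ n := by
  let e : Matrix (Fin m) (Fin n) F ≃ₗ[ℝ] (Fin n → Fin m → F) :=
    (Matrix.transposeLinearEquiv (Fin m) (Fin n) ℝ F).trans (Matrix.ofLinearEquiv ℝ).symm
  have h : e.toLinearMap ∘ₗ mulLeftReal n L ∘ₗ e.symm.toLinearMap =
      LinearMap.pi fun j => mulVecReal L ∘ₗ LinearMap.proj j := by
    refine LinearMap.ext fun X => ?_
    rfl
  rw [← LinearMap.det_conj (mulLeftReal n L) e, h, LinearMap.det_pi]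
  simp

theorem posDef_conj_iff {A B : Matrix (Fin m) (Fin m) F} (hB : IsUnit B) :
    PosDef (B * A * Bᴴ) ↔ PosDef A := by
  refine ⟨fun h => ?_, fun h => h.conj hB⟩
  obtain ⟨C, hBC, hCB⟩ := isUnit_iff_exists.1 hB
  have h2 := h.conj (isUnit_iff_exists.2 ⟨B, hCB, hBC⟩)
  have h3 : Bᴴ * Cᴴ = 1 := by rw [← Matrix.conjTranspose_mul, hCB, Matrix.conjTranspose_one]
  have h4 : C * (B * A * Bᴴ) * Cᴴ = C * B * A * (Bᴴ * Cᴴ) := by simp only [Matrix.mul_assoc]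
  rwa [h4, hCB, h3, Matrix.one_mul, Matrix.mul_one] at h2

theorem lebesgue_eq_map [MeasurableSpace F] :
    lebesgue F m n = (volume : Measure (Fin m → Fin n → Fin (dim F) → ℝ)).map
      (matrixCoordEquiv F m n) := by
  rw [lebesgue]
  congr 1
  exact funext fun c => (matrixCoordEquiv_apply c).symm

variable [MeasurableSpace F] [BorelSpace F]

theorem measurable_matrixCoordEquiv : Measurable (matrixCoordEquiv F m n) :=
  (LinearMap.continuous_of_finiteDimensional (matrixCoordEquiv F m n).toLinearMap).measurable

instance instSFiniteLebesgue : SFinite (lebesgue F m n) := by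
  rw [lebesgue]
  infer_instance

theorem lebesgue_univ_ne_zero : lebesgue F m n Set.univ ≠ 0 := by
  rw [lebesgue_eq_map, Measure.map_apply measurable_matrixCoordEquiv .univ, Set.preimage_univ]
  exact (Measure.measure_univ_eq_zero.not).2 (NeZero.ne volume)

theorem lintegral_lebesgue {h : Matrix (Fin m) (Fin n) F → ENNReal} (hh : Measurable h) :
    ∫⁻ X, h X ∂lebesgue F m n = ∫⁻ c, h (matrixCoordEquiv F m n c) := by
  rw [lebesgue_eq_map, lintegral_map hh measurable_matrixCoordEquiv]

theorem lintegral_lebesgue_mul_left {L : Matrix (Fin m) (Fin m) F} (hL : IsUnit L)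
    {h : Matrix (Fin m) (Fin n) F → ENNReal} (hh : Measurable h) :
    ∫⁻ X, h X ∂lebesgue F m n =
      ENNReal.ofReal (det L ^ (beta F * n)) * ∫⁻ X, h (L * X) ∂lebesgue F m n := by
  let e := matrixCoordEquiv F m n
  have hdet : LinearMap.det
      (e.symm.toLinearMap ∘ₗ mulLeftReal n L ∘ₗ e.toLinearMap) =
      LinearMap.det (mulVecReal L) ^ n := by
    rw [← det_mulLeftReal, ← LinearMap.det_conj (mulLeftReal n L) e.symm]
    rfl
  have hdet' : |LinearMap.det (mulVecReal L) ^ n| = det L ^ (beta F * n) := by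
    rw [abs_pow, abs_det_mulVecReal, ← pow_mul, ← Real.rpow_natCast, Nat.cast_mul]
  have hpos : 0 < det L ^ (beta F * n) := Real.rpow_pos_of_pos (det_pos_of_isUnit hL) _
  have hmul : Measurable fun X : Matrix (Fin m) (Fin n) F => L * X :=
    (continuous_const.matrix_mul continuous_id).measurable
  rw [lintegral_lebesgue hh, lintegral_lebesgue (h := fun X => h (L * X)) (hh.comp hmul),
    lintegral_map_linearMap (h := fun c => h (e c)) volume
      (e.symm.toLinearMap ∘ₗ mulLeftReal n L ∘ₗ e.toLinearMap)
      (by rw [hdet, ← abs_ne_zero, hdet']; exact hpos.ne')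
      (hh.comp measurable_matrixCoordEquiv), hdet, hdet']
  congr 2
  funext c
  change h (e (e.symm _)) = _
  rw [LinearEquiv.apply_symm_apply]
  rfl

theorem lintegral_lebesgue_add_right (Z : Matrix (Fin m) (Fin n) F)
    {h : Matrix (Fin m) (Fin n) F → ENNReal} (hh : Measurable h) :
    ∫⁻ X, h (X + Z) ∂lebesgue F m n = ∫⁻ X, h X ∂lebesgue F m n := by
  have hadd : Measurable fun X : Matrix (Fin m) (Fin n) F => X + Z :=
    (continuous_id.add continuous_const).measurable
  rw [lintegral_lebesgue hh, lintegral_lebesgue (h := fun X => h (X + Z)) (hh.comp hadd),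
    ← lintegral_add_right_eq_self (μ := volume) (fun c => h (matrixCoordEquiv F m n c))
      ((matrixCoordEquiv F m n).symm Z)]
  simp

theorem measurable_hermitianOfCoord :
    Measurable (hermitianOfCoord : HermitianCoord F m → Matrix (Fin m) (Fin m) F) :=
  (LinearMap.continuous_of_finiteDimensional (hermitianLinear F m)).measurable

theorem lintegral_cone {h : Matrix (Fin m) (Fin m) F → ENNReal} (hh : Measurable h) :
    ∫⁻ A, h A ∂lebesgueCone F m = ∫⁻ c : HermitianCoord F m,
      {A : Matrix (Fin m) (Fin m) F | PosDef A}.indicator h (hermitianOfCoord c) := by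
  rw [lebesgueCone, ← lintegral_indicator measurableSet_posDef, lebesgueHermitian,
    lintegral_map (hh.indicator measurableSet_posDef) measurable_hermitianOfCoord]

/-- An invertible congruence maps the cone onto itself, so the linear change of variables in
Hermitian coordinates restricts to it. -/
theorem lintegral_cone_congruence {B : Matrix (Fin m) (Fin m) F} (hB : IsUnit B)
    {h : Matrix (Fin m) (Fin m) F → ENNReal} (hh : Measurable h) :
    ∫⁻ A, h A ∂lebesgueCone F m =
      ENNReal.ofReal |LinearMap.det (congruence B)| * ∫⁻ A, h (B * A * Bᴴ) ∂lebesgueCone F m := by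
  have hdet : LinearMap.det (congruence B) ≠ 0 := by
    obtain ⟨C, hBC, -⟩ := isUnit_iff_exists.1 hB
    intro h0
    have : LinearMap.det (congruence (B * C)) = 1 := by
      rw [hBC, congruence_one, LinearMap.det_id]
    rw [congruence_mul, LinearMap.det_comp, h0, zero_mul] at this
    exact zero_ne_one this
  have hmul : Measurable fun A : Matrix (Fin m) (Fin m) F => B * A * Bᴴ :=
    ((continuous_const.matrix_mul continuous_id).matrix_mul continuous_const).measurable
  rw [lintegral_cone hh, lintegral_cone (h := fun A => h (B * A * Bᴴ)) (hh.comp hmul),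
    lintegral_map_linearMap volume (congruence B) hdet (h := fun c =>
      {A : Matrix (Fin m) (Fin m) F | PosDef A}.indicator h (hermitianOfCoord c))
      ((hh.indicator measurableSet_posDef).comp measurable_hermitianOfCoord)]
  congr 2
  funext c
  rw [hermitianOfCoord_congruence]
  by_cases hc : PosDef (hermitianOfCoord (F := F) c)
  · rw [Set.indicator_of_mem (show _ ∈ {A | PosDef A} from hc),
      Set.indicator_of_mem (show _ ∈ {A | PosDef A} from (posDef_conj_iff hB).2 hc)]
  · rw [Set.indicator_of_notMem (show _ ∉ {A | PosDef A} from hc), Set.indicator_of_notMem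
      (show _ ∉ {A | PosDef A} from fun h' => hc ((posDef_conj_iff hB).1 h'))]

end Measure

/-! ### Gamma integrals and the Laplace transform on the cone. -/

section Gamma

variable {F : Type*} [NormedDivisionRing F] [NormedAlgebra ℝ F] [StarRing F]
  [RealNormedDivisionAlgebra F] {m n : ℕ}

theorem det_smul {c : ℝ} (hc : 0 ≤ c) (A : Matrix (Fin m) (Fin m) F) :
    det (c • A) = c ^ m * det A := by
  have h : c • A = realDiagonal F (fun _ => c) * A := by
    ext i j
    simp [realDiagonal, Algebra.smul_def]
  rw [h, det_mul, realDiagonal, det_diagonal _ fun _ => hc]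
  simp

theorem PosDef.smul {A : Matrix (Fin m) (Fin m) F} (hA : PosDef A) {c : ℝ} (hc : 0 < c) :
    PosDef (c • A) := by
  refine ⟨by rw [conjTranspose_smul_real, hA.1], fun x hx => ?_⟩
  rw [Matrix.smul_mulVec, dotProduct_smul, re_smul]
  exact mul_pos hc (hA.2 x hx)

theorem det_conjTranspose_mul_self (B : Matrix (Fin m) (Fin m) F) :
    det (Bᴴ * B) = det B ^ 2 := by
  rw [det_mul, det_conjTranspose, sq]

theorem isUnit_of_posDef_conjTranspose_mul_self {L : Matrix (Fin m) (Fin m) F}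
    (h : PosDef (Lᴴ * L)) : IsUnit L := by
  refine isUnit_of_mulVec_injective fun x hx => ?_
  by_contra hne
  have := h.2 x hne
  rw [← Matrix.mulVec_mulVec, hx, Matrix.mulVec_zero, dotProduct_zero, re_zero] at this
  exact lt_irrefl _ this

variable [MeasurableSpace F]

variable (F m) in
/-- The integral `∫ etr(-A) |A| ^ p (dA)` over the cone, with values in `[0, ∞]`. -/
noncomputable def gammaLintegral (p : ℝ) : ENNReal :=
  ∫⁻ A, ENNReal.ofReal (Real.exp (-re (Matrix.trace A)) * det A ^ p) ∂lebesgueCone F m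

variable [BorelSpace F]

theorem measurable_re_trace_mul (A : Matrix (Fin m) (Fin n) F) :
    Measurable fun V : Matrix (Fin n) (Fin m) F => re (Matrix.trace (A * V)) :=
  (continuous_re.comp (continuous_const.matrix_mul continuous_id).matrix_trace).measurable

theorem measurable_gamma_integrand (p : ℝ) :
    Measurable fun A : Matrix (Fin m) (Fin m) F =>
      Real.exp (-re (Matrix.trace A)) * det A ^ p :=
  ((continuous_re.comp continuous_id.matrix_trace).measurable.neg.exp).mul
    (continuous_det.measurable.pow_const p)

theorem measurable_det_rpow_mul_exp (A : Matrix (Fin m) (Fin m) F) (c p : ℝ) :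
    Measurable fun V : Matrix (Fin m) (Fin m) F =>
      det V ^ p * Real.exp (-c * re (Matrix.trace (A * V))) :=
  (continuous_det.measurable.pow_const p).mul ((measurable_re_trace_mul A).const_mul (-c)).exp

/-- A divergent integral gives `0` on both sides, so no convergence is needed. -/
theorem multiGamma_eq_toReal (a : ℝ) :
    multiGamma F m a = (gammaLintegral F m (a - ((m : ℝ) - 1) * beta F / 2 - 1)).toReal :=
  integral_eq_lintegral_of_nonneg_ae
    (Filter.Eventually.of_forall fun A =>
      mul_nonneg (Real.exp_pos _).le (Real.rpow_nonneg (det_nonneg A) _))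
    (measurable_gamma_integrand _).aestronglyMeasurable

theorem multiGamma_nonneg (a : ℝ) : 0 ≤ multiGamma F m a := by
  rw [multiGamma_eq_toReal]
  exact ENNReal.toReal_nonneg

/-- The Laplace transform of a power of the determinant on the cone. -/
theorem lintegral_cone_det_rpow_mul_exp {A : Matrix (Fin m) (Fin m) F} (hA : PosDef A) {c : ℝ}
    (hc : 0 < c) (p : ℝ) :
    ∫⁻ V, ENNReal.ofReal (det V ^ p * Real.exp (-c * re (Matrix.trace (A * V))))
        ∂lebesgueCone F m =
      ENNReal.ofReal ((c ^ m * det A) ^ (-(p + ((m : ℝ) - 1) * beta F / 2 + 1))) *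
        gammaLintegral F m p := by
  -- With `c • A = Bᴴ * B`, cyclicity gives `Re tr (B V Bᴴ) = c Re tr (A V)`, so substituting `B V
  -- Bᴴ` in the Gamma integral produces the required integrand.
  obtain ⟨W, d, hW, hd, hfac⟩ := (hA.smul hc).exists_factorization
  set B := realDiagonal F d * W with hBdef
  have hB : IsUnit B := isUnit_of_posDef_conjTranspose_mul_self (hfac ▸ hA.smul hc)
  have hBpos := det_pos_of_isUnit hB
  have hdetA : c ^ m * det A = det B ^ 2 := by
    rw [← det_smul hc.le, hfac, det_conjTranspose_mul_self]
  have hint : ∀ V : Matrix (Fin m) (Fin m) F,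
      ENNReal.ofReal (Real.exp (-re (Matrix.trace (B * V * Bᴴ))) * det (B * V * Bᴴ) ^ p) =
      ENNReal.ofReal (det B ^ (2 * p)) *
        ENNReal.ofReal (det V ^ p * Real.exp (-c * re (Matrix.trace (A * V)))) := by
    intro V
    have htr : re (Matrix.trace (B * V * Bᴴ)) = c * re (Matrix.trace (A * V)) := by
      rw [re_trace_mul_comm, ← Matrix.mul_assoc, ← hfac, Matrix.smul_mul, Matrix.trace_smul,
        re_smul]
    have hd2 : det (B * V * Bᴴ) = det B ^ (2 : ℝ) * det V := by
      rw [det_mul, det_mul, det_conjTranspose, Real.rpow_two]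
      ring
    rw [← ENNReal.ofReal_mul (Real.rpow_nonneg hBpos.le _), htr, hd2,
      Real.mul_rpow (Real.rpow_nonneg hBpos.le _) (det_nonneg V), ← Real.rpow_mul hBpos.le]
    congr 1
    rw [neg_mul]
    ring
  have key := lintegral_cone_congruence hB (measurable_gamma_integrand (F := F) p).ennreal_ofReal
  simp only [hint] at key
  rw [lintegral_const_mul _ (measurable_det_rpow_mul_exp A c p).ennreal_ofReal, ← mul_assoc,
    abs_det_congruence hW hd, ← hBdef, ← ENNReal.ofReal_mul (Real.rpow_nonneg hBpos.le _),
    ← Real.rpow_add hBpos] at key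
  rw [gammaLintegral, key, ← mul_assoc, hdetA,
    ← ENNReal.ofReal_mul (Real.rpow_nonneg (sq_nonneg _) _), ← Real.rpow_two, ← Real.rpow_mul hBpos.le, ← Real.rpow_add hBpos]
  -- The exponents of `|B|` from the claimed factor, the Jacobian and `det (B V Bᴴ) ^ p` cancel.
  have h0 : 2 * -(p + ((m : ℝ) - 1) * beta F / 2 + 1) +
      (2 + ((m : ℝ) - 1) * beta F + 2 * p) = 0 := by ring
  rw [h0, Real.rpow_zero, ENNReal.ofReal_one, one_mul]

end Gamma

/-! ### Conditional density and its Wishart average. -/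

section Mixture

variable {F : Type*} [NormedDivisionRing F] [NormedAlgebra ℝ F] [StarRing F]
  [RealNormedDivisionAlgebra F] {m n : ℕ}

/-- The density at `T` of `L⁻¹ Y + μ` for a deterministic `L` with `Lᴴ L = V` and `Y` normal
with parameters `0` and `1 ⊗ S`. -/
noncomputable def conditionalDensity (S : Matrix (Fin n) (Fin n) F)
    (μ T : Matrix (Fin m) (Fin n) F) (V : Matrix (Fin m) (Fin m) F) : ℝ :=
  det V ^ (beta F * n / 2) *
    (1 / ((2 * Real.pi / beta F) ^ (beta F * m * n / 2) * det S ^ (beta F * m / 2)) *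
      Real.exp (-(beta F / 2) *
        re (Matrix.trace ((T - μ) * Ring.inverse S * (T - μ)ᴴ * V))))

theorem conditionalDensity_conjTranspose_mul_self (S : Matrix (Fin n) (Fin n) F)
    (μ T : Matrix (Fin m) (Fin n) F) (L : Matrix (Fin m) (Fin m) F) :
    conditionalDensity S μ T (Lᴴ * L) =
      det L ^ (beta F * n) * normalDensity 0 1 S (L * (T - μ)) := by
  have hdet : det (Lᴴ * L) ^ (beta F * n / 2) = det L ^ (beta F * n) := by
    rw [det_conjTranspose_mul_self, ← Real.rpow_two, ← Real.rpow_mul (det_nonneg L)]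
    congr 1
    ring
  have htr : re (Matrix.trace ((T - μ) * Ring.inverse S * (T - μ)ᴴ * (Lᴴ * L))) =
      re (Matrix.trace (L * (T - μ) * Ring.inverse S * (L * (T - μ))ᴴ)) := by
    rw [← Matrix.mul_assoc, re_trace_mul_comm, Matrix.conjTranspose_mul]
    simp only [Matrix.mul_assoc]
  rw [conditionalDensity, normalDensity, hdet, htr, sub_zero, det_one, Real.one_rpow, mul_one,
    Ring.inverse_one, Matrix.one_mul]

variable [MeasurableSpace F] [BorelSpace F]

theorem measurable_normalDensity (S : Matrix (Fin n) (Fin n) F) :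
    Measurable (normalDensity (0 : Matrix (Fin m) (Fin n) F) 1 S) := by
  have h : Continuous fun Y : Matrix (Fin m) (Fin n) F =>
      re (Matrix.trace (Ring.inverse (1 : Matrix (Fin m) (Fin m) F) * (Y - 0) *
        Ring.inverse S * (Y - 0)ᴴ)) := by
    have h0 : Continuous fun Y : Matrix (Fin m) (Fin n) F => Y - 0 :=
      continuous_id.sub continuous_const
    exact continuous_re.comp (((continuous_const.matrix_mul h0).matrix_mul
      continuous_const).matrix_mul h0.matrix_conjTranspose).matrix_trace
  exact ((h.measurable.const_mul _).exp).const_mul _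

theorem measurable_wishartDensity (ν : ℝ) (Ξ : Matrix (Fin m) (Fin m) F) :
    Measurable (wishartDensity ν Ξ) :=
  ((continuous_det.measurable.pow_const _).const_mul _).mul
    ((measurable_re_trace_mul _).const_mul _).exp

theorem measurable_conditionalDensity (S : Matrix (Fin n) (Fin n) F)
    (μ : Matrix (Fin m) (Fin n) F) :
    Measurable fun z : Matrix (Fin m) (Fin n) F × Matrix (Fin m) (Fin m) F =>
      conditionalDensity S μ z.1 z.2 := by
  have h : Continuous fun z : Matrix (Fin m) (Fin n) F × Matrix (Fin m) (Fin m) F =>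
      re (Matrix.trace ((z.1 - μ) * Ring.inverse S * (z.1 - μ)ᴴ * z.2)) := by
    have h0 : Continuous fun z : Matrix (Fin m) (Fin n) F × Matrix (Fin m) (Fin m) F =>
        z.1 - μ := continuous_fst.sub continuous_const
    exact continuous_re.comp (((h0.matrix_mul continuous_const).matrix_mul
      h0.matrix_conjTranspose).matrix_mul continuous_snd).matrix_trace
  exact ((continuous_det.comp continuous_snd).measurable.pow_const _).mul
    (((h.measurable.const_mul _).exp).const_mul _)

/-- The law of `L⁻¹ Y + μ` for a deterministic invertible `L`. -/
theorem lintegral_normal_inverse_mul_add (S : Matrix (Fin n) (Fin n) F)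
    (μ : Matrix (Fin m) (Fin n) F) {L : Matrix (Fin m) (Fin m) F} (hL : IsUnit L)
    {g : Matrix (Fin m) (Fin n) F → ENNReal} (hg : Measurable g) :
    ∫⁻ Y, g (Ring.inverse L * Y + μ)
        ∂((lebesgue F m n).withDensity fun Y => ENNReal.ofReal (normalDensity 0 1 S Y)) =
      ∫⁻ T, g T * ENNReal.ofReal (conditionalDensity S μ T (Lᴴ * L)) ∂lebesgue F m n := by
  have hN := (measurable_normalDensity (F := F) (m := m) S).ennreal_ofReal
  have hmap : Measurable fun Y : Matrix (Fin m) (Fin n) F => g (Ring.inverse L * Y + μ) :=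
    hg.comp ((continuous_const.matrix_mul continuous_id).add continuous_const).measurable
  have hcd : Measurable fun T : Matrix (Fin m) (Fin n) F =>
      g T * ENNReal.ofReal (conditionalDensity S μ T (Lᴴ * L)) :=
    hg.mul ((measurable_conditionalDensity S μ).comp
      (measurable_id.prodMk measurable_const)).ennreal_ofReal
  rw [lintegral_withDensity_eq_lintegral_mul _ hN hmap,
    lintegral_lebesgue_mul_left hL (hN.mul hmap), ← lintegral_const_mul' _ _
      ENNReal.ofReal_ne_top, ← lintegral_lebesgue_add_right μ hcd]
  refine lintegral_congr fun T => ?_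
  have h1 : Ring.inverse L * (L * T) = T := by
    rw [← Matrix.mul_assoc, Ring.inverse_mul_cancel L hL, Matrix.one_mul]
  simp only [Pi.mul_apply, h1, conditionalDensity_conjTranspose_mul_self,
    add_sub_cancel_right]
  rw [ENNReal.ofReal_mul (Real.rpow_nonneg (det_nonneg L) _)]
  ring

/-- Bookkeeping of constants: `G`, `X`, `Z` stand for the Gamma factor and the powers of `|Ξ|` and
`|Σ|`, and `D` for `|A|`. The powers of `2 / β` in the two normalisations cancel against `(β / 2) ^
m`. -/
theorem conditional_constant {b : ℝ} (hb : 0 < b) (G X Z : ℝ) (m n : ℕ) (ν D : ℝ) (hD : 0 ≤ D) :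
    1 / ((2 / b) ^ (b * m * ν / 2) * G * X) *
        (1 / ((2 * Real.pi / b) ^ (b * m * n / 2) * Z)) *
        ((b / 2) ^ m * D) ^ (-(b * (n + ν) / 2)) =
      1 / (Real.pi ^ ((m : ℝ) * n * b / 2) * G * X * Z) * D ^ (-(b * (n + ν) / 2)) := by
  have hπ := Real.pi_pos
  have h2b : 0 < 2 / b := by positivity
  have h1 : (2 * Real.pi / b) ^ (b * m * n / 2) =
      (2 / b) ^ (b * m * n / 2) * Real.pi ^ ((m : ℝ) * n * b / 2) := by
    rw [show 2 * Real.pi / b = 2 / b * Real.pi by ring, Real.mul_rpow h2b.le hπ.le]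
    congr 2
    ring
  have h2 : ((b / 2) ^ m * D) ^ (-(b * (n + ν) / 2)) =
      (2 / b) ^ (b * m * ν / 2) * (2 / b) ^ (b * m * n / 2) * D ^ (-(b * (n + ν) / 2)) := by
    rw [Real.mul_rpow (by positivity) hD, ← Real.rpow_add h2b, ← Real.rpow_natCast,
      ← Real.rpow_mul (by positivity), show b / 2 = (2 / b)⁻¹ by rw [inv_div],
      Real.inv_rpow h2b.le, ← Real.rpow_neg h2b.le]
    congr 2
    ring
  have h3 : (2 / b) ^ (b * m * ν / 2) ≠ 0 := (Real.rpow_pos_of_pos h2b _).ne'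
  have h4 : (2 / b) ^ (b * m * n / 2) ≠ 0 := (Real.rpow_pos_of_pos h2b _).ne'
  rw [h1, h2]
  simp only [one_div, mul_inv]
  field_simp

/-- The mixture of the conditional densities with respect to the Wishart distribution. -/
theorem lintegral_wishart_conditionalDensity {ν : ℝ} {Ξ : Matrix (Fin m) (Fin m) F}
    (hΞ : PosDef Ξ) {S : Matrix (Fin n) (Fin n) F} (hS : PosDef S)
    (μ T : Matrix (Fin m) (Fin n) F) :
    ∫⁻ V, ENNReal.ofReal (conditionalDensity S μ T V)
        ∂((lebesgueCone F m).withDensity fun V => ENNReal.ofReal (wishartDensity ν Ξ V)) =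
      ENNReal.ofReal (1 / (Real.pi ^ ((m : ℝ) * n * beta F / 2) * multiGamma F m (beta F * ν / 2) *
          det Ξ ^ (beta F * ν / 2) * det S ^ (beta F * m / 2)) *
        det (Ring.inverse Ξ + (T - μ) * Ring.inverse S * (T - μ)ᴴ) ^
          (-(beta F * (n + ν) / 2))) *
      gammaLintegral F m (beta F * (n + ν) / 2 - ((m : ℝ) - 1) * beta F / 2 - 1) := by
  have hb : 0 < beta F := beta_pos
  have hA : PosDef (Ring.inverse Ξ + (T - μ) * Ring.inverse S * (T - μ)ᴴ) :=
    hΞ.inverse.add_conj hS.inverse (T - μ)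
  set p := beta F * (n + ν) / 2 - ((m : ℝ) - 1) * beta F / 2 - 1 with hp
  have hpe : -(p + ((m : ℝ) - 1) * beta F / 2 + 1) = -(beta F * (n + ν) / 2) := by
    rw [hp]; ring
  set cW := 1 / ((2 / beta F) ^ (beta F * m * ν / 2) * multiGamma F m (beta F * ν / 2) *
      det Ξ ^ (beta F * ν / 2)) with hcW
  set cN := 1 / ((2 * Real.pi / beta F) ^ (beta F * m * n / 2) * det S ^ (beta F * m / 2)) with hcN
  have hcN0 : 0 ≤ cN := by
    have := Real.pi_pos
    have := Real.rpow_nonneg hS.det_pos.le (beta F * m / 2)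
    positivity
  have hcW0 : 0 ≤ cW := by
    have := multiGamma_nonneg (F := F) (m := m) (beta F * ν / 2)
    have := Real.rpow_nonneg hΞ.det_pos.le (beta F * ν / 2)
    positivity
  have hT : Measurable fun V : Matrix (Fin m) (Fin m) F =>
      ENNReal.ofReal (conditionalDensity S μ T V) :=
    ((measurable_conditionalDensity S μ).comp
      (measurable_const.prodMk measurable_id)).ennreal_ofReal
  rw [lintegral_withDensity_eq_lintegral_mul _
    (measurable_wishartDensity ν Ξ).ennreal_ofReal hT]
  -- Restricting to the cone gives `det V > 0`, which is needed to add the exponents of the two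
  -- powers of `det V`.
  have hint : ∀ᵐ V ∂lebesgueCone F m,
      ((fun V => ENNReal.ofReal (wishartDensity ν Ξ V)) *
        fun V => ENNReal.ofReal (conditionalDensity S μ T V)) V =
      ENNReal.ofReal (cW * cN) * ENNReal.ofReal (det V ^ p * Real.exp (-(beta F / 2) *
        re (Matrix.trace ((Ring.inverse Ξ + (T - μ) * Ring.inverse S * (T - μ)ᴴ) * V)))) := by
    filter_upwards [ae_restrict_mem measurableSet_posDef] with V hV
    have hVpos : 0 < det V := PosDef.det_pos hV
    have hW0 : 0 ≤ wishartDensity ν Ξ V :=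
      mul_nonneg (mul_nonneg hcW0 (Real.rpow_nonneg hVpos.le _)) (Real.exp_pos _).le
    have hpow : det V ^ p =
        det V ^ (beta F * (ν - m + 1) / 2 - 1) * det V ^ (beta F * n / 2) := by
      rw [← Real.rpow_add hVpos, hp]
      congr 1
      ring
    rw [Pi.mul_apply, ← ENNReal.ofReal_mul hW0, ← ENNReal.ofReal_mul (mul_nonneg hcW0 hcN0),
      Matrix.add_mul, Matrix.trace_add, re_add, mul_add, Real.exp_add, hpow, wishartDensity,
      conditionalDensity, ← hcW, ← hcN]
    congr 1
    ring
  rw [lintegral_congr_ae hint, lintegral_const_mul' _ _ ENNReal.ofReal_ne_top,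
    lintegral_cone_det_rpow_mul_exp hA (half_pos hb), hpe, ← mul_assoc,
    ← ENNReal.ofReal_mul (mul_nonneg hcW0 hcN0), hcW, hcN,
    conditional_constant hb _ _ _ _ _ _ _ hA.det_pos.le]

end Mixture

/-! ### Random matrices: the law of `L⁻¹ Y + μ`. -/

section Main

variable {F : Type*} [NormedDivisionRing F] [NormedAlgebra ℝ F] [StarRing F]
  [RealNormedDivisionAlgebra F] [MeasurableSpace F]
  {Ω : Type*} [MeasurableSpace Ω] {P : Measure Ω} {m n : ℕ}

/-- If this value were zero, division by zero would make the density vanish identically,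
contradicting total mass one. This also excludes a divergent Gamma integral, whose value is `0` by
convention. -/
theorem IsWishart.multiGamma_ne_zero [IsProbabilityMeasure P]
    {V : Ω → Matrix (Fin m) (Fin m) F} {ν : ℝ} {Ξ : Matrix (Fin m) (Fin m) F}
    (hV : IsWishart V P ν Ξ) : multiGamma F m (beta F * ν / 2) ≠ 0 := by
  intro h0
  have h1 : wishartDensity ν Ξ = fun _ => 0 := by
    funext W
    simp [wishartDensity, h0]
  have h2 : P.map V Set.univ = 1 := by
    have := Measure.isProbabilityMeasure_map hV.1
    exact measure_univ
  rw [hV.2, h1] at h2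
  simp at h2

variable [BorelSpace F]

theorem IsWishart.ae_posDef {V : Ω → Matrix (Fin m) (Fin m) F} {ν : ℝ}
    {Ξ : Matrix (Fin m) (Fin m) F} (hV : IsWishart V P ν Ξ) : ∀ᵐ ω ∂P, PosDef (V ω) := by
  refine ae_of_ae_map hV.1 ?_
  rw [hV.2]
  exact (withDensity_absolutelyContinuous _ _).ae_le (ae_restrict_mem measurableSet_posDef)

theorem aemeasurable_inverse_mul_add {L : Ω → Matrix (Fin m) (Fin m) F}
    {Y : Ω → Matrix (Fin m) (Fin n) F} (hL : AEMeasurable L P) (hY : AEMeasurable Y P)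
    (hunit : ∀ᵐ ω ∂P, IsUnit (L ω)) (μ : Matrix (Fin m) (Fin n) F) :
    AEMeasurable (fun ω => Ring.inverse (L ω) * Y ω + μ) P := by
  obtain ⟨f, hf, hfi⟩ := exists_measurable_inverse (F := F) (m := m)
  have hc : Continuous fun z : Matrix (Fin m) (Fin m) F × Matrix (Fin m) (Fin n) F =>
      z.1 * z.2 + μ := (continuous_fst.matrix_mul continuous_snd).add continuous_const
  refine (hc.measurable.comp_aemeasurable
    ((hf.comp_aemeasurable hL).prodMk hY)).congr ?_
  filter_upwards [hunit] with ω hω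
  simp [hfi _ hω]

/-- The law of `L⁻¹ Y + μ` is the mixture of its conditional laws given `Lᴴ L = V`. -/
theorem lintegral_inverse_mul_add [IsProbabilityMeasure P]
    {V L : Ω → Matrix (Fin m) (Fin m) F} {Y : Ω → Matrix (Fin m) (Fin n) F}
    {S : Matrix (Fin n) (Fin n) F} (μ : Matrix (Fin m) (Fin n) F)
    (hY : IsMatrixNormal Y P 0 1 S) (hV : AEMeasurable V P)
    (hL : AEMeasurable L P) (hLV : ∀ᵐ ω ∂P, (L ω)ᴴ * L ω = V ω)
    (hunit : ∀ᵐ ω ∂P, IsUnit (L ω)) (hLY : IndepFun L Y P)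
    {g : Matrix (Fin m) (Fin n) F → ENNReal} (hg : Measurable g) :
    ∫⁻ ω, g (Ring.inverse (L ω) * Y ω + μ) ∂P =
      ∫⁻ T, g T * ∫⁻ v, ENNReal.ofReal (conditionalDensity S μ T v) ∂(P.map V)
        ∂lebesgue F m n := by
  obtain ⟨f, hf, hfi⟩ := exists_measurable_inverse (F := F) (m := m)
  have := Measure.isProbabilityMeasure_map hY.1
  have := Measure.isProbabilityMeasure_map hL
  have := Measure.isProbabilityMeasure_map hV
  have hc : Continuous fun z : Matrix (Fin m) (Fin m) F × Matrix (Fin m) (Fin n) F =>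
      z.1 * z.2 + μ := (continuous_fst.matrix_mul continuous_snd).add continuous_const
  have hm : Measurable fun z : Matrix (Fin m) (Fin m) F × Matrix (Fin m) (Fin n) F =>
      g (f z.1 * z.2 + μ) :=
    hg.comp (hc.measurable.comp ((hf.comp measurable_fst).prodMk measurable_snd))
  have hk : Measurable fun z : Matrix (Fin m) (Fin m) F × Matrix (Fin m) (Fin n) F =>
      g z.2 * ENNReal.ofReal (conditionalDensity S μ z.2 z.1) :=
    (hg.comp measurable_snd).mul
      ((measurable_conditionalDensity S μ).comp measurable_swap).ennreal_ofReal
  calc ∫⁻ ω, g (Ring.inverse (L ω) * Y ω + μ) ∂P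
      = ∫⁻ ω, g (f (L ω) * Y ω + μ) ∂P := by
        refine lintegral_congr_ae ?_
        filter_upwards [hunit] with ω hω
        rw [hfi _ hω]
    _ = ∫⁻ z, g (f z.1 * z.2 + μ) ∂(P.map fun ω => (L ω, Y ω)) :=
        (lintegral_map' hm.aemeasurable (hL.prodMk hY.1)).symm
    -- Independence is used here: the joint law of `(L, Y)` is a product.
    _ = ∫⁻ l, ∫⁻ y, g (f l * y + μ) ∂(P.map Y) ∂(P.map L) := by
        rw [(indepFun_iff_map_prod_eq_prod_map_map hL hY.1).1 hLY,
          lintegral_prod _ hm.aemeasurable]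
    _ = ∫⁻ ω, ∫⁻ y, g (f (L ω) * y + μ) ∂(P.map Y) ∂P :=
        lintegral_map' hm.lintegral_prod_right'.aemeasurable hL
    -- From here on `L` enters only through `V`, so no joint independence of `V` and `Y` is
    -- required.
    _ = ∫⁻ ω, ∫⁻ T, g T * ENNReal.ofReal (conditionalDensity S μ T (V ω)) ∂lebesgue F m n ∂P := by
        refine lintegral_congr_ae ?_
        filter_upwards [hunit, hLV] with ω hω hω'
        rw [hfi _ hω, hY.2, lintegral_normal_inverse_mul_add S μ hω hg, hω']
    _ = ∫⁻ v, ∫⁻ T, g T * ENNReal.ofReal (conditionalDensity S μ T v) ∂lebesgue F m n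
          ∂(P.map V) :=
        (lintegral_map' (hk.lintegral_prod_right').aemeasurable hV).symm
    _ = ∫⁻ T, ∫⁻ v, g T * ENNReal.ofReal (conditionalDensity S μ T v) ∂(P.map V)
          ∂lebesgue F m n := lintegral_lintegral_swap hk.aemeasurable
    _ = _ := by
        refine lintegral_congr fun T => ?_
        exact lintegral_const_mul _ ((measurable_conditionalDensity S μ).comp
          (measurable_const.prodMk measurable_id)).ennreal_ofReal

end Main

end MatricT

theorem mainTheorem1 {F : Type*} [NormedDivisionRing F] [NormedAlgebra ℝ F] [StarRing F]
    [MatricT.RealNormedDivisionAlgebra F] [MeasurableSpace F] [BorelSpace F]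
    {Ω : Type*} [MeasurableSpace Ω] (P : Measure Ω) [IsProbabilityMeasure P]
    {m n : ℕ} (ν : ℝ) (hν : MatricT.beta F * ((m : ℝ) - 1) < ν)
    (Ξ : Matrix (Fin m) (Fin m) F) (hΞ : MatricT.PosDef Ξ)
    (S : Matrix (Fin n) (Fin n) F) (hS : MatricT.PosDef S)
    (μ : Matrix (Fin m) (Fin n) F)
    (V L : Ω → Matrix (Fin m) (Fin m) F) (Y : Ω → Matrix (Fin m) (Fin n) F)
    (hV : MatricT.IsWishart V P ν Ξ)
    (hY : MatricT.IsMatrixNormal Y P 0 1 S)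
    (hL : AEMeasurable L P) (hLV : ∀ᵐ ω ∂P, (L ω)ᴴ * L ω = V ω)
    (hLY : IndepFun L Y P) :
    MatricT.HasDensity (fun ω => Ring.inverse (L ω) * Y ω + μ) P (MatricT.lebesgue F m n)
      (fun T =>
        MatricT.multiGamma F m (MatricT.beta F * (n + ν) / 2) /
          (Real.pi ^ ((m : ℝ) * n * MatricT.beta F / 2) *
            MatricT.multiGamma F m (MatricT.beta F * ν / 2) *
            MatricT.det Ξ ^ (MatricT.beta F * ν / 2) *
            MatricT.det S ^ (MatricT.beta F * m / 2)) *
          MatricT.det (Ring.inverse Ξ + (T - μ) * Ring.inverse S * (T - μ)ᴴ) ^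
            (-(MatricT.beta F * (n + ν) / 2))) := by
  have hunit : ∀ᵐ ω ∂P, IsUnit (L ω) := by
    filter_upwards [hV.ae_posDef, hLV] with ω h1 h2
    exact MatricT.isUnit_of_posDef_conjTranspose_mul_self (h2 ▸ h1)
  have hT := MatricT.aemeasurable_inverse_mul_add hL hY.1 hunit μ
  refine ⟨hT, ?_⟩
  set G := MatricT.gammaLintegral F m
    (MatricT.beta F * (n + ν) / 2 - ((m : ℝ) - 1) * MatricT.beta F / 2 - 1) with hG
  set k : Matrix (Fin m) (Fin n) F → ℝ := fun T =>
    1 / (Real.pi ^ ((m : ℝ) * n * MatricT.beta F / 2) *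
        MatricT.multiGamma F m (MatricT.beta F * ν / 2) *
        MatricT.det Ξ ^ (MatricT.beta F * ν / 2) * MatricT.det S ^ (MatricT.beta F * m / 2)) *
      MatricT.det (Ring.inverse Ξ + (T - μ) * Ring.inverse S * (T - μ)ᴴ) ^
        (-(MatricT.beta F * (n + ν) / 2)) with hk
  have hkpos : ∀ T, 0 < k T := by
    intro T
    have h1 := Real.rpow_pos_of_pos Real.pi_pos ((m : ℝ) * n * MatricT.beta F / 2)
    have h2 : 0 < MatricT.multiGamma F m (MatricT.beta F * ν / 2) :=
      (MatricT.multiGamma_nonneg _).lt_of_ne' hV.multiGamma_ne_zero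
    have h3 := Real.rpow_pos_of_pos hΞ.det_pos (MatricT.beta F * ν / 2)
    have h4 := Real.rpow_pos_of_pos hS.det_pos (MatricT.beta F * m / 2)
    have h5 := Real.rpow_pos_of_pos (hΞ.inverse.add_conj hS.inverse (T - μ)).det_pos
      (-(MatricT.beta F * (n + ν) / 2))
    simp only [hk]
    positivity
  have key : ∀ g : Matrix (Fin m) (Fin n) F → ENNReal, Measurable g →
      ∫⁻ ω, g (Ring.inverse (L ω) * Y ω + μ) ∂P =
        ∫⁻ T, g T * (ENNReal.ofReal (k T) * G) ∂MatricT.lebesgue F m n := by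
    intro g hg
    rw [MatricT.lintegral_inverse_mul_add μ hY hV.1 hL hLV hunit hLY hg]
    refine lintegral_congr fun T => ?_
    rw [hV.2, MatricT.lintegral_wishart_conditionalDensity hΞ hS μ T]
  -- Testing `key` on the constant `1` gives total mass one, whereas an infinite `G` would make the
  -- right-hand side infinite, since `k` is positive and Lebesgue measure is nonzero.
  have hGtop : G ≠ ⊤ := by
    intro htop
    have h1 := key (fun _ => 1) measurable_const
    have h2 : ∀ T, (1 : ENNReal) * (ENNReal.ofReal (k T) * G) = ⊤ := fun T => by
      rw [htop, one_mul, ENNReal.mul_top (ENNReal.ofReal_pos.2 (hkpos T)).ne']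
    simp only [h2, lintegral_const, measure_univ, one_mul] at h1
    rw [ENNReal.top_mul MatricT.lebesgue_univ_ne_zero] at h1
    exact ENNReal.one_ne_top h1
  refine Measure.ext fun s hs => ?_
  have h1 := key (s.indicator 1) (measurable_one.indicator hs)
  rw [← lintegral_map' (measurable_one.indicator hs).aemeasurable hT, lintegral_indicator_one hs]
    at h1
  rw [h1, withDensity_apply _ hs, ← lintegral_indicator hs]
  refine lintegral_congr fun T => ?_
  by_cases hTs : T ∈ s
  -- Finiteness of `G` lets it be replaced by the real number `multiGamma`.
  · rw [Set.indicator_of_mem hTs, Set.indicator_of_mem hTs, Pi.one_apply, one_mul,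
      MatricT.multiGamma_eq_toReal (MatricT.beta F * (n + ν) / 2), ← hG,
      ← ENNReal.ofReal_toReal hGtop, ← ENNReal.ofReal_mul (hkpos T).le,
      ENNReal.toReal_ofReal ENNReal.toReal_nonneg]
    congr 1
    simp only [hk]
    ring
  · rw [Set.indicator_of_notMem hTs, Set.indicator_of_notMem hTs, zero_mul]
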